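/- All graphs are simple and may be infinite, disconnected and of arbitrary cardinality. A ray of a graph $G$ is a one-way infinite path in $G$, and a tail of a ray is an infinite connected subgraph of it. A set $S\subset V(G)$ of vertices (respectively, a set $F\subset E(G)$ of edges) separates two rays if they have no tails lying in the same connected component of $G\setminus S$ (respectively, of $G\setminus F$). Two rays $r,s$ are equivalent, $r\sim s$, if no finite set of vertices separates them; the classes $[r]$ are the ends of $G$, and the end space $\Omega(G)$ is the set of ends with the topology whose basic open sets are $$\Omega(S,[r])=\{[s]\in\Omega(G): S\text{ does not separate }r\text{ and }s\},\qquad S\subset V(G)\text{ finite}.$$ They are edge-equivalent, $r\sim_E s$, if no finite set of edges separates them; the classes $[r]_E$ are the edge-ends of $G$, and the edge-end space $\Omega_E(G)$ is the set of edge-ends with the topology whose basic open sets are $$\Omega_E(F,[r]_E)=\{[s]_E\in\Omega_E(G): F\text{ does not separate }r\text{ and }s\},\qquad F\subset E(G)\text{ finite}.$$ A vertex $v$ edge-dominates a ray $r$ if for every finite $F\subset E(G)$ the vertex $v$ and a tail of $r$ lie in the same connected component of $G\setminus F$; it edge-dominates an end $\omega\in\Omega(G)$ if it edge-dominates every ray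 of $\omega$ (equivalently, some ray of $\omega$). **Theorem.** Let $G$ be a graph in which every vertex edge-dominates at most one end of $\Omega(G)$. Then there is a graph $H$ such that $\Omega_E(H)$ is homeomorphic to $\Omega(G)$. -/

import Mathlib

universe u

namespace EndSpaces

variable {V : Type u} (G : SimpleGraph V)

/-- A ray of `G`: a one-way infinite path, given by the sequence of its vertices. -/
structure Ray where
  vert : ℕ → V
  injective : Function.Injective vert
  adj : ∀ n, G.Adj (vert n) (vert (n + 1))

variable {G}

/-! ### Separation by finitely many vertices, ends, and the end space -/

/-- `a` and `b` lie in the same connected component of `G ∖ S`, where `S` is a set of vertices: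
some walk of `G` from `a` to `b` has all its vertices (in particular `a` and `b`) outside `S`. -/
def JoinedOff (G : SimpleGraph V) (S : Set V) (a b : V) : Prop :=
  ∃ p : G.Walk a b, ∀ x ∈ p.support, x ∉ S

/-- The set `S` of vertices separates the rays `r` and `s`: there are no tail of `r` and tail
of `s` that lie in the same connected component of `G ∖ S`. -/
def Separates (S : Set V) (r s : Ray G) : Prop :=
  ¬ ∃ N, ∀ m ≥ N, ∀ n ≥ N, JoinedOff G S (r.vert m) (s.vert n)

theorem JoinedOff.symm {S : Set V} {a b : V} (h : JoinedOff G S a b) : JoinedOff G S b a := by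
  obtain ⟨p, hp⟩ := h
  exact ⟨p.reverse, fun x hx => hp x (by simpa using hx)⟩

theorem JoinedOff.trans {S : Set V} {a b c : V} (h : JoinedOff G S a b)
    (h' : JoinedOff G S b c) : JoinedOff G S a c := by
  obtain ⟨p, hp⟩ := h
  obtain ⟨q, hq⟩ := h'
  refine ⟨p.append q, fun x hx => ?_⟩
  rcases (SimpleGraph.Walk.mem_support_append_iff p q).1 hx with hx | hx
  · exact hp x hx
  · exact hq x hx

/-- A tail of a ray is connected, and it avoids a given finite set of vertices. -/
theorem not_separates_self {S : Set V} (hS : S.Finite) (r : Ray G) : ¬ Separates S r r := by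
  refine not_not.2 ?_
  have hfin : (r.vert ⁻¹' S).Finite := hS.preimage r.injective.injOn
  obtain ⟨N, hN⟩ := hfin.bddAbove
  have hout : ∀ n ≥ N + 1, r.vert n ∉ S := fun n hn hmem => by
    have := hN (show n ∈ r.vert ⁻¹' S from hmem)
    omega
  have key : ∀ k, JoinedOff G S (r.vert (N + 1)) (r.vert (N + 1 + k)) := by
    intro k
    induction k with
    | zero =>
      refine ⟨SimpleGraph.Walk.nil, fun x hx => ?_⟩
      rw [SimpleGraph.Walk.support_nil, List.mem_singleton] at hx
      exact hx ▸ hout _ le_rfl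
    | succ k ih =>
      refine ih.trans ⟨(r.adj (N + 1 + k)).toWalk, fun x hx => ?_⟩
      have hx' : x = r.vert (N + 1 + k) ∨ x = r.vert (N + 1 + k + 1) := by simpa using hx
      rcases hx' with rfl | rfl
      · exact hout _ (by omega)
      · exact hout _ (by omega)
  refine ⟨N + 1, fun m hm n hn => ?_⟩
  have h1 := key (m - (N + 1))
  have h2 := key (n - (N + 1))
  rw [Nat.add_sub_cancel' hm] at h1
  rw [Nat.add_sub_cancel' hn] at h2
  exact h1.symm.trans h2

theorem not_separates_symm {S : Set V} {r s : Ray G} (h : ¬ Separates S r s) :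
    ¬ Separates S s r := by
  obtain ⟨N, hN⟩ := not_not.1 h
  exact not_not.2 ⟨N, fun m hm n hn => (hN n hn m hm).symm⟩

theorem not_separates_trans {S : Set V} {r s t : Ray G} (h : ¬ Separates S r s)
    (h' : ¬ Separates S s t) : ¬ Separates S r t := by
  obtain ⟨N, hN⟩ := not_not.1 h
  obtain ⟨M, hM⟩ := not_not.1 h'
  exact not_not.2 ⟨max N M, fun m hm n hn =>
    (hN m (le_trans (le_max_left _ _) hm) (max N M) (le_max_left _ _)).trans
      (hM (max N M) (le_max_right _ _) n (le_trans (le_max_right _ _) hn))⟩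

/-- The end relation `∼`: no finite set of vertices separates the two rays. -/
def endSetoid (G : SimpleGraph V) : Setoid (Ray G) where
  r r s := ∀ S : Set V, S.Finite → ¬ Separates S r s
  iseqv :=
    { refl := fun r _ hS => not_separates_self hS r
      symm := fun h S hS => not_separates_symm (h S hS)
      trans := fun h h' S hS => not_separates_trans (h S hS) (h' S hS) }

/-- The set `Ω(G)` of ends of `G`. -/
def Ends (G : SimpleGraph V) : Type u := Quotient (endSetoid G)

/-- The end `[r]` of a ray `r`. -/
def Ray.toEnd (r : Ray G) : Ends G := Quotient.mk (endSetoid G) r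

/-- The basic neighbourhood `Ω(S, [r])`: the ends `[s]` such that `S` does not separate
`r` and `s`. -/
def endNhd (S : Set V) (r : Ray G) : Set (Ends G) :=
  {ω | ∃ s : Ray G, s.toEnd = ω ∧ ¬ Separates S r s}

/-- The end space topology, generated by the sets `Ω(S, [r])` with `S` finite. -/
instance (G : SimpleGraph V) : TopologicalSpace (Ends G) :=
  TopologicalSpace.generateFrom {U | ∃ (S : Set V) (r : Ray G), S.Finite ∧ U = endNhd S r}

/-! ### Separation by finitely many edges, edge-ends, and the edge-end space -/

/-- The set `F` of edges separates the rays `r` and `s`: there are no tail of `r` and tail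
of `s` that lie in the same connected component of `G ∖ F`. -/
def EdgeSeparates (F : Set (Sym2 V)) (r s : Ray G) : Prop :=
  ¬ ∃ N, ∀ m ≥ N, ∀ n ≥ N, (G.deleteEdges F).Reachable (r.vert m) (s.vert n)

/-- Every walk that avoids all end vertices of the edges in `F` is a walk of `G ∖ F`. -/
theorem JoinedOff.reachable {F : Set (Sym2 V)} {a b : V}
    (h : JoinedOff G {v | ∃ e ∈ F, v ∈ e} a b) : (G.deleteEdges F).Reachable a b := by
  obtain ⟨p, hp⟩ := h
  refine ⟨p.toDeleteEdges F fun e he heF => ?_⟩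
  induction e with
  | _ x y =>
    exact hp x (p.fst_mem_support_of_mem_edges he) ⟨s(x, y), heF, Sym2.mem_mk_left x y⟩

theorem finite_ends_of_finite {F : Set (Sym2 V)} (hF : F.Finite) :
    {v | ∃ e ∈ F, v ∈ e}.Finite := by
  have : {v | ∃ e ∈ F, v ∈ e} = ⋃ e ∈ F, {v | v ∈ e} := by ext; simp
  rw [this]
  refine hF.biUnion fun e _ => ?_
  induction e with
  | _ x y => exact (Set.toFinite {x, y}).subset fun v hv => by simpa using hv

theorem not_edgeSeparates_of_not_separates {F : Set (Sym2 V)} {r s : Ray G}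
    (h : ¬ Separates {v | ∃ e ∈ F, v ∈ e} r s) : ¬ EdgeSeparates F r s := by
  obtain ⟨N, hN⟩ := not_not.1 h
  exact not_not.2 ⟨N, fun m hm n hn => (hN m hm n hn).reachable⟩

theorem not_edgeSeparates_symm {F : Set (Sym2 V)} {r s : Ray G} (h : ¬ EdgeSeparates F r s) :
    ¬ EdgeSeparates F s r := by
  obtain ⟨N, hN⟩ := not_not.1 h
  exact not_not.2 ⟨N, fun m hm n hn => (hN n hn m hm).symm⟩

theorem not_edgeSeparates_trans {F : Set (Sym2 V)} {r s t : Ray G} (h : ¬ EdgeSeparates F r s)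
    (h' : ¬ EdgeSeparates F s t) : ¬ EdgeSeparates F r t := by
  obtain ⟨N, hN⟩ := not_not.1 h
  obtain ⟨M, hM⟩ := not_not.1 h'
  exact not_not.2 ⟨max N M, fun m hm n hn =>
    (hN m (le_trans (le_max_left _ _) hm) (max N M) (le_max_left _ _)).trans
      (hM (max N M) (le_max_right _ _) n (le_trans (le_max_right _ _) hn))⟩

/-- The edge-end relation `∼_E`: no finite set of edges separates the two rays. -/
def edgeEndSetoid (G : SimpleGraph V) : Setoid (Ray G) where
  r r s := ∀ F : Set (Sym2 V), F ⊆ G.edgeSet → F.Finite → ¬ EdgeSeparates F r s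
  iseqv :=
    { refl := fun r _ _ hF =>
        not_edgeSeparates_of_not_separates (not_separates_self (finite_ends_of_finite hF) r)
      symm := fun h F hG hF => not_edgeSeparates_symm (h F hG hF)
      trans := fun h h' F hG hF => not_edgeSeparates_trans (h F hG hF) (h' F hG hF) }

/-- The set `Ω_E(G)` of edge-ends of `G`. -/
def EdgeEnds (G : SimpleGraph V) : Type u := Quotient (edgeEndSetoid G)

/-- The edge-end `[r]_E` of a ray `r`. -/
def Ray.toEdgeEnd (r : Ray G) : EdgeEnds G := Quotient.mk (edgeEndSetoid G) r

/-- The basic neighbourhood `Ω_E(F, [r]_E)`: the edge-ends `[s]_E` such that `F` does not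
separate `r` and `s`. -/
def edgeEndNhd (F : Set (Sym2 V)) (r : Ray G) : Set (EdgeEnds G) :=
  {ω | ∃ s : Ray G, s.toEdgeEnd = ω ∧ ¬ EdgeSeparates F r s}

/-- The edge-end space topology, generated by the sets `Ω_E(F, [r]_E)` with `F` a finite set
of edges. -/
instance (G : SimpleGraph V) : TopologicalSpace (EdgeEnds G) :=
  TopologicalSpace.generateFrom
    {U | ∃ (F : Set (Sym2 V)) (r : Ray G), F ⊆ G.edgeSet ∧ F.Finite ∧ U = edgeEndNhd F r}

/-! ### Edge-domination -/

/-- The vertex `v` edge-dominates the ray `r`: for every finite set `F` of edges, `v` and a tail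
of `r` lie in the same connected component of `G ∖ F`. -/
def EdgeDominates (v : V) (r : Ray G) : Prop :=
  ∀ F : Set (Sym2 V), F ⊆ G.edgeSet → F.Finite →
    ∃ N, ∀ n ≥ N, (G.deleteEdges F).Reachable v (r.vert n)

/-- The vertex `v` edge-dominates the end `ω` (a class of the relation `∼`): it edge-dominates
every ray of `ω`. -/
def EdgeDominatesEnd (v : V) (ω : Ends G) : Prop :=
  ∀ r : Ray G, r.toEnd = ω → EdgeDominates v r

/-- Edge-domination of an end can be tested on any one of its rays. -/
theorem edgeDominatesEnd_toEnd (v : V) (r : Ray G) :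
    EdgeDominatesEnd v r.toEnd ↔ EdgeDominates v r := by
  refine ⟨fun h => h r rfl, fun h s hs F hG hF => ?_⟩
  have hrs : ∀ S : Set V, S.Finite → ¬ Separates S s r := Quotient.exact hs
  obtain ⟨N, hN⟩ := h F hG hF
  obtain ⟨M, hM⟩ := not_not.1
    (not_edgeSeparates_of_not_separates (hrs _ (finite_ends_of_finite hF)))
  exact ⟨M, fun n hn => (hN (max N M) (le_max_left _ _)).trans
    (hM n hn (max N M) (le_max_right _ _)).symm⟩

end EndSpaces

/-! Trees with fans realise, as edge-end spaces, all spaces with an address system: clopen sets `U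
s` on the nodes of a tree, children being disjoint subsets of their parent, such that addresses
separate points, every infinite branch of nonempty sets contains a point, and each point has small
neighbourhoods of the form `U s` minus finitely many children. A point whose address stops at `s`
becomes a ray starting at `s`, with `s` joined to all its other vertices; deleting finitely many
edges then disconnects only finitely many children from `s`. So it suffices to find an address
system on the end space of `G`.

It comes from repeatedly decomposing a connected set `A` with finite edge boundary at a vertex `m`
of `A` (`Decomp`). By hypothesis at most one end is edge-dominated by `m`; it stays behind at this
node. All other rays in `A` have tails in connected pieces avoiding `m`, again with finite edge
boundary. The pieces are bundled into groups, an intermediate layer of the tree: each group is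
separated from the end left behind by finitely many vertices, while for every finite `S` the rays in
pieces of all but finitely many groups are not separated from it by `S`.

To decompose, let `m` edge-dominate `r`. Finite vertex separators can be traded for mixed ones, made
of edges and of vertices in the edge-block of `m` (`exists_isSep_near`). Now cut `A` by mixed
separators again and again, until the part around a vertex is separated from `r` by one of them;
this happens after finitely many cuts (`exists_not_bad`). The pieces are the components of such a
good part minus the edge-block. Their boundaries are finite by a star-comb argument
(`exists_ray_edgeDominates`): otherwise a good part would contain a ray edge-dominated by `m`, hence
equivalent to `r`. A group consists of the pieces from good parts with the same bad parent and the
same finite set of neighbours in the core.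

Finally, boundary vertices are queued as future decomposition vertices. Hence the sets along an
infinite branch have empty intersection, and such a branch captures exactly one end
(`exists_ray_of_chain`, `not_separates_of_evIn_seq`). -/

namespace EndSpaces

variable {V : Type u} {G : SimpleGraph V}

/-! ### Walks avoiding sets, edge boundaries and tails of rays -/

/-- The ray `r` has a tail in `A`. -/
def Ray.EvIn (r : Ray G) (A : Set V) : Prop := ∃ N, ∀ n ≥ N, r.vert n ∈ A

/-- The edge boundary of `A`. -/
def bd (G : SimpleGraph V) (A : Set V) : Set (Sym2 V) :=
  {e | ∃ x y, G.Adj x y ∧ x ∈ A ∧ y ∉ A ∧ e = s(x, y)}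

/-- `A` induces a connected (or empty) subgraph. -/
def ConnSet (G : SimpleGraph V) (A : Set V) : Prop := ∀ a ∈ A, ∀ b ∈ A, JoinedOff G Aᶜ a b

/-- The set of end vertices of the edges in `F`. -/
def touch (F : Set (Sym2 V)) : Set V := {v | ∃ e ∈ F, v ∈ e}

/-- The component of `v` in `G ∖ S`. -/
def comp (G : SimpleGraph V) (S : Set V) (v : V) : Set V := {u | JoinedOff G S v u}

theorem left_mem_touch {F : Set (Sym2 V)} {x y : V} (h : s(x, y) ∈ F) : x ∈ touch F :=
  ⟨_, h, Sym2.mem_mk_left x y⟩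

theorem right_mem_touch {F : Set (Sym2 V)} {x y : V} (h : s(x, y) ∈ F) : y ∈ touch F :=
  ⟨_, h, Sym2.mem_mk_right x y⟩

theorem touch_finite {F : Set (Sym2 V)} (hF : F.Finite) : (touch F).Finite :=
  finite_ends_of_finite hF

namespace JoinedOff

variable {S : Set V} {a b c : V}

theorem refl (h : a ∉ S) : JoinedOff G S a a :=
  ⟨SimpleGraph.Walk.nil, fun x hx => by
    rw [SimpleGraph.Walk.support_nil, List.mem_singleton] at hx; exact hx ▸ h⟩

theorem of_adj (hab : G.Adj a b) (ha : a ∉ S) (hb : b ∉ S) : JoinedOff G S a b :=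
  ⟨hab.toWalk, fun x hx => by
    have hx' : x = a ∨ x = b := by simpa using hx
    rcases hx' with rfl | rfl
    exacts [ha, hb]⟩

theorem mono {G' : SimpleGraph V} {S' : Set V} (h : JoinedOff G S a b) (hG : G ≤ G')
    (hS : S' ⊆ S) : JoinedOff G' S' a b := by
  obtain ⟨p, hp⟩ := h
  refine ⟨p.mapLe hG, fun x hx hxS => hp x ?_ (hS hxS)⟩
  simpa using hx

theorem right_notMem (h : JoinedOff G S a b) : b ∉ S := by
  obtain ⟨p, hp⟩ := h
  exact hp _ p.end_mem_support

theorem left_notMem (h : JoinedOff G S a b) : a ∉ S := h.symm.right_notMem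

theorem induct {P : V → Prop} (h : JoinedOff G S a b) (ha : P a)
    (hs : ∀ x y, P x → x ∉ S → y ∉ S → G.Adj x y → P y) : P b := by
  obtain ⟨p, hp⟩ := h
  induction p with
  | nil => exact ha
  | cons hadj p ih =>
    refine ih (hs _ _ ha (hp _ (by simp)) (hp _ (by simp)) hadj) fun x hx => hp x ?_
    simp [hx]

/-- A walk starting in a set that cannot be left stays inside it. -/
theorem mem_and_joined {L : Set V} (h : JoinedOff G S a b) (ha : a ∈ L)
    (hs : ∀ x y, x ∈ L → x ∉ S → y ∉ S → G.Adj x y → y ∈ L) :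
    JoinedOff G (L ∩ Sᶜ)ᶜ a b := by
  have : b ∈ L ∧ JoinedOff G (L ∩ Sᶜ)ᶜ a b := by
    refine h.induct (P := fun b => b ∈ L ∧ JoinedOff G (L ∩ Sᶜ)ᶜ a b)
      ⟨ha, refl (by simp [ha, h.left_notMem])⟩ ?_
    rintro x y ⟨hx, hj⟩ hxS hyS hxy
    have hy := hs x y hx hxS hyS hxy
    exact ⟨hy, hj.trans (of_adj hxy (by simp [hx, hxS]) (by simp [hy, hyS]))⟩
  exact this.2

end JoinedOff

theorem joinedOff_empty_iff {a b : V} : JoinedOff G ∅ a b ↔ G.Reachable a b :=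
  ⟨fun ⟨p, _⟩ => ⟨p⟩, fun ⟨p⟩ => ⟨p, by simp⟩⟩

theorem JoinedOff.to_reachable {S : Set V} {a b : V} (h : JoinedOff G S a b) : G.Reachable a b :=
  h.elim fun p _ => ⟨p⟩

theorem comp_eq {S : Set V} {u v : V} (h : u ∈ comp G S v) : comp G S u = comp G S v := by
  ext w
  exact ⟨fun hw => JoinedOff.trans h hw, fun hw => (JoinedOff.symm h).trans hw⟩

theorem comp_disjoint {S : Set V} {v : V} : comp G S v ⊆ Sᶜ := fun _ h => JoinedOff.right_notMem h

theorem connSet_comp (S : Set V) (v : V) : ConnSet G (comp G S v) := by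
  intro a ha b hb
  have h : JoinedOff G S a b := (JoinedOff.symm ha).trans hb
  refine (h.mem_and_joined (L := comp G S v) ha fun x y hx hxS hyS hxy =>
    JoinedOff.trans hx (JoinedOff.of_adj hxy hxS hyS)).mono le_rfl ?_
  intro x hx hx'
  exact hx hx'.1

theorem ConnSet.joinedOff {A S : Set V} (h : ConnSet G A) (hS : Disjoint A S) {a b : V}
    (ha : a ∈ A) (hb : b ∈ A) : JoinedOff G S a b :=
  (h a ha b hb).mono le_rfl fun _ hx hA => Set.disjoint_left.1 hS hA hx

/-- A connected set that contains no end vertex of an edge in `F` stays connected in `G ∖ F`. -/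
theorem ConnSet.deleteEdges {A : Set V} {F : Set (Sym2 V)} (h : ConnSet G A)
    (hF : Disjoint A (touch F)) : ConnSet (G.deleteEdges F) A := by
  intro a ha b hb
  refine (h a ha b hb).induct (P := fun b => JoinedOff (G.deleteEdges F) Aᶜ a b)
    (JoinedOff.refl (by simpa using ha)) ?_
  intro x y hx hxA hyA hxy
  refine hx.trans (JoinedOff.of_adj ?_ hxA hyA)
  rw [SimpleGraph.deleteEdges_adj]
  exact ⟨hxy, fun he => Set.disjoint_left.1 hF (not_not.1 hxA) (left_mem_touch he)⟩

theorem ConnSet.of_le {G' : SimpleGraph V} {A : Set V} (h : ConnSet G A) (hG : G ≤ G') :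
    ConnSet G' A := fun a ha b hb => (h a ha b hb).mono hG subset_rfl

theorem bd_compl (A : Set V) : bd G Aᶜ = bd G A := by
  ext e
  constructor
  · rintro ⟨x, y, h, hx, hy, rfl⟩
    exact ⟨y, x, h.symm, by simpa using hy, hx, Sym2.eq_swap⟩
  · rintro ⟨x, y, h, hx, hy, rfl⟩
    exact ⟨y, x, h.symm, hy, by simpa using hx, Sym2.eq_swap⟩

namespace Ray

variable {r s : Ray G} {A B : Set V}

theorem EvIn.mono (h : r.EvIn A) (hAB : A ⊆ B) : r.EvIn B := by
  obtain ⟨N, hN⟩ := h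
  exact ⟨N, fun n hn => hAB (hN n hn)⟩

theorem EvIn.inter (h : r.EvIn A) (h' : r.EvIn B) : r.EvIn (A ∩ B) := by
  obtain ⟨N, hN⟩ := h
  obtain ⟨M, hM⟩ := h'
  exact ⟨max N M, fun n hn => ⟨hN n (le_trans (le_max_left _ _) hn),
    hM n (le_trans (le_max_right _ _) hn)⟩⟩

theorem EvIn.nonempty (h : r.EvIn A) : A.Nonempty := by
  obtain ⟨N, hN⟩ := h
  exact ⟨_, hN N le_rfl⟩

theorem EvIn.not_compl (h : r.EvIn A) : ¬ r.EvIn Aᶜ := fun h' => by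
  obtain ⟨x, hx, hx'⟩ := (h.inter h').nonempty
  exact hx' hx

theorem evIn_compl_of_finite {S : Set V} (hS : S.Finite) (r : Ray G) : r.EvIn Sᶜ := by
  have hfin : (r.vert ⁻¹' S).Finite := hS.preimage r.injective.injOn
  obtain ⟨N, hN⟩ := hfin.bddAbove
  refine ⟨N + 1, fun n hn hmem => ?_⟩
  have := hN (show n ∈ r.vert ⁻¹' S from hmem)
  omega

/-- A ray eventually uses no edge of a given finite set. -/
theorem exists_forall_edge_notMem {F : Set (Sym2 V)} (hF : F.Finite) (r : Ray G) :
    ∃ N, ∀ n ≥ N, s(r.vert n, r.vert (n + 1)) ∉ F := by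
  obtain ⟨N, hN⟩ := evIn_compl_of_finite (touch_finite hF) r
  exact ⟨N, fun n hn he => hN n hn (left_mem_touch he)⟩

theorem tail_joined {S : Set V} {F : Set (Sym2 V)} (hF : F.Finite) (h : r.EvIn Sᶜ) :
    ∃ N, ∀ m ≥ N, ∀ n ≥ N, JoinedOff (G.deleteEdges F) S (r.vert m) (r.vert n) := by
  obtain ⟨N, hN⟩ := h
  obtain ⟨M, hM⟩ := exists_forall_edge_notMem hF r
  have key : ∀ k, JoinedOff (G.deleteEdges F) S (r.vert (max N M)) (r.vert (max N M + k)) := by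
    intro k
    induction k with
    | zero => exact JoinedOff.refl (hN _ (le_max_left _ _))
    | succ k ih =>
      refine ih.trans (JoinedOff.of_adj ?_ (hN _ (by omega)) (hN _ (by omega)))
      rw [SimpleGraph.deleteEdges_adj]
      exact ⟨r.adj _, hM _ (by omega)⟩
  refine ⟨max N M, fun m hm n hn => ?_⟩
  have h1 := key (m - max N M)
  have h2 := key (n - max N M)
  rw [Nat.add_sub_cancel' hm] at h1
  rw [Nat.add_sub_cancel' hn] at h2
  exact h1.symm.trans h2

/-- A ray has a tail on one side of a finite cut. -/
theorem evIn_or_compl (hA : (bd G A).Finite) (r : Ray G) : r.EvIn A ∨ r.EvIn Aᶜ := by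
  obtain ⟨N, hN⟩ := exists_forall_edge_notMem hA r
  by_cases h : r.vert N ∈ A
  · left
    refine ⟨N, fun n hn => ?_⟩
    induction n, hn using Nat.le_induction with
    | base => exact h
    | succ n hn ih =>
      by_contra hc
      exact hN n hn ⟨_, _, r.adj n, ih, hc, rfl⟩
  · right
    refine ⟨N, fun n hn => ?_⟩
    induction n, hn using Nat.le_induction with
    | base => exact h
    | succ n hn ih =>
      intro hc
      exact hN n hn ⟨_, _, (r.adj n).symm, hc, ih, Sym2.eq_swap⟩

end Ray

theorem reachable_mem_of_bd_subset {A : Set V} {F : Set (Sym2 V)} (hF : bd G A ⊆ F) {a b : V}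
    (h : (G.deleteEdges F).Reachable a b) (ha : a ∈ A) : b ∈ A := by
  refine (joinedOff_empty_iff.2 h).induct (P := fun b => b ∈ A) ha ?_
  intro x y hx _ _ hxy
  rw [SimpleGraph.deleteEdges_adj] at hxy
  by_contra hy
  exact hxy.2 (hF ⟨x, y, hxy.1, hx, hy, rfl⟩)

theorem Ray.EvIn.of_not_edgeSeparates {A : Set V} {F : Set (Sym2 V)} (hF : bd G A ⊆ F)
    {r s : Ray G} (h : ¬ EdgeSeparates F r s) (hr : r.EvIn A) : s.EvIn A := by
  obtain ⟨N, hN⟩ := not_not.1 h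
  obtain ⟨M, hM⟩ := hr
  exact ⟨N, fun n hn => reachable_mem_of_bd_subset hF (hN (max N M) (le_max_left _ _) n hn)
    (hM _ (le_max_right _ _))⟩

theorem Ray.EvIn.of_not_separates {A : Set V} {r s : Ray G}
    (h : ¬ Separates (touch (bd G A)) r s) (hr : r.EvIn A) : s.EvIn A :=
  hr.of_not_edgeSeparates subset_rfl (not_edgeSeparates_of_not_separates h)

theorem toEnd_eq_iff {r s : Ray G} :
    r.toEnd = s.toEnd ↔ ∀ S : Set V, S.Finite → ¬ Separates S r s := Quotient.eq (r := endSetoid G)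

theorem toEdgeEnd_eq_iff {r s : Ray G} : r.toEdgeEnd = s.toEdgeEnd ↔
    ∀ F : Set (Sym2 V), F ⊆ G.edgeSet → F.Finite → ¬ EdgeSeparates F r s :=
  Quotient.eq (r := edgeEndSetoid G)

theorem bd_subset_edgeSet (A : Set V) : bd G A ⊆ G.edgeSet := by
  rintro _ ⟨x, y, h, _, _, rfl⟩
  exact h

theorem Ray.EvIn.of_toEnd_eq {A : Set V} (hA : (bd G A).Finite) {r s : Ray G}
    (h : r.toEnd = s.toEnd) (hr : r.EvIn A) : s.EvIn A :=
  hr.of_not_separates (toEnd_eq_iff.1 h _ (touch_finite hA))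

theorem Ray.EvIn.of_toEdgeEnd_eq {A : Set V} (hA : (bd G A).Finite) {r s : Ray G}
    (h : r.toEdgeEnd = s.toEdgeEnd) (hr : r.EvIn A) : s.EvIn A :=
  hr.of_not_edgeSeparates subset_rfl (toEdgeEnd_eq_iff.1 h _ (bd_subset_edgeSet A) hA)

/-! ### Spaces addressed by a tree are edge-end spaces -/

section AddressTree

variable {X : Type u} {I : Type u}

/-- The first `n` letters of an infinite address, the last letter first. -/
def initSeg (f : ℕ → I) : ℕ → List I
  | 0 => []
  | n + 1 => f n :: initSeg f n

theorem length_initSeg (f : ℕ → I) (n : ℕ) : (initSeg f n).length = n := by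
  induction n with
  | zero => rfl
  | succ n ih => simp [initSeg, ih]

variable {U : List I → Set X}

/-- Some point of `U s` lies in no `U (i :: s)`. -/
def Term (U : List I → Set X) (s : List I) : Prop := ∃ x ∈ U s, ∀ i, x ∉ U (i :: s)

/-- The tree of all nodes with nonempty `U s`, where a dominated ray (a fan) is attached to each
node `s` with `Term U s`. -/
def fanTree (U : List I → Set X) : SimpleGraph (List I × ℕ) :=
  SimpleGraph.fromRel fun a b =>
    (∃ i, b.1 = i :: a.1 ∧ a.2 = 0 ∧ b.2 = 0 ∧ (U b.1).Nonempty) ∨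
      (a.1 = b.1 ∧ Term U a.1 ∧ (a.2 = 0 ∨ b.2 = a.2 + 1))

/-- The vertices at or above the node `s`. -/
def above (s : List I) : Set (List I × ℕ) := {p | s <:+ p.1}

theorem fanTree_adj_cons {i : I} {s : List I} (h : (U (i :: s)).Nonempty) :
    (fanTree U).Adj (s, 0) (i :: s, 0) := by
  rw [fanTree, SimpleGraph.fromRel_adj]
  exact ⟨by simp, Or.inl (Or.inl ⟨i, rfl, rfl, rfl, h⟩)⟩

theorem fanTree_adj_zero {s : List I} (h : Term U s) (n : ℕ) :
    (fanTree U).Adj (s, 0) (s, n + 1) := by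
  rw [fanTree, SimpleGraph.fromRel_adj]
  exact ⟨by simp, Or.inl (Or.inr ⟨rfl, h, Or.inl rfl⟩)⟩

theorem fanTree_adj_succ {s : List I} (h : Term U s) (n : ℕ) :
    (fanTree U).Adj (s, n) (s, n + 1) := by
  rw [fanTree, SimpleGraph.fromRel_adj]
  exact ⟨by simp, Or.inl (Or.inr ⟨rfl, h, Or.inr rfl⟩)⟩

theorem fanTree_adj_cases {a b : List I × ℕ} (h : (fanTree U).Adj a b) :
    (∃ i, b.1 = i :: a.1 ∧ a.2 = 0 ∧ b.2 = 0 ∧ (U b.1).Nonempty) ∨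
    (∃ i, a.1 = i :: b.1 ∧ a.2 = 0 ∧ b.2 = 0 ∧ (U a.1).Nonempty) ∨
    (a.1 = b.1 ∧ Term U a.1) := by
  rw [fanTree, SimpleGraph.fromRel_adj] at h
  obtain ⟨-, (h | h) | (h | h)⟩ := h
  · exact Or.inl h
  · exact Or.inr (Or.inr ⟨h.1, h.2.1⟩)
  · obtain ⟨i, h1, h2, h3, h4⟩ := h
    exact Or.inr (Or.inl ⟨i, h1, h3, h2, h4⟩)
  · exact Or.inr (Or.inr ⟨h.1.symm, h.1 ▸ h.2.1⟩)

/-- A fan lives at a single node, so only the tree edge below `s` leaves `above s`. This makes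
`above s` one side of a finite cut, and every edge-end chooses a side. For the root the claim is
vacuous. -/
theorem fanTree_leave {s : List I} {a b : List I × ℕ} (h : (fanTree U).Adj a b)
    (ha : a ∈ above s) (hb : b ∉ above s) : a = (s, 0) ∧ b = (s.tail, 0) := by
  obtain ⟨a, k⟩ := a
  obtain ⟨b, l⟩ := b
  simp only [above, Set.mem_ofPred_eq] at ha hb
  rcases fanTree_adj_cases h with ⟨i, h1, h2, h3, -⟩ | ⟨i, h1, h2, h3, -⟩ | ⟨h1, -⟩
  · simp only at h1
    exact absurd (h1 ▸ ha.trans (List.suffix_cons i a)) hb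
  · simp only at h1 h2 h3
    subst h1 h2 h3
    rcases List.suffix_cons_iff.1 ha with rfl | h'
    · exact ⟨rfl, rfl⟩
    · exact absurd h' hb
  · simp only at h1
    exact absurd (h1 ▸ ha) hb

theorem bd_above_finite (s : List I) : (bd (fanTree U) (above s)).Finite := by
  refine (Set.finite_singleton s((s, 0), (s.tail, 0))).subset ?_
  rintro _ ⟨x, y, h, hx, hy, rfl⟩
  obtain ⟨rfl, rfl⟩ := fanTree_leave h hx hy
  rfl

theorem exists_cons_suffix {s t : List I} (h : s <:+ t) (hne : t ≠ s) : ∃ i, i :: s <:+ t := by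
  obtain ⟨l, rfl⟩ := h
  rcases List.eq_nil_or_concat l with rfl | ⟨l', i, rfl⟩
  · simp at hne
  · exact ⟨i, l', by simp⟩

theorem term_of_adj_succ {a b : List I × ℕ} (h : (fanTree U).Adj a b) (ha : a.2 ≠ 0) :
    Term U a.1 := by
  rcases fanTree_adj_cases h with ⟨i, -, h2, -⟩ | ⟨i, -, h2, -⟩ | ⟨-, h⟩
  · exact absurd h2 ha
  · exact absurd h2 ha
  · exact h

/-- The ray `ρ` of the fan tree converges to the point `x`. -/
def Lim (ρ : Ray (fanTree U)) (x : X) : Prop := ∀ s, x ∈ U s ↔ ρ.EvIn (above s)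

/-- A ray that stays above `s`, but not above any child of `s`, ends in the fan at `s`. -/
theorem evIn_fan {ρ : Ray (fanTree U)} {s : List I} (hs : ρ.EvIn (above s))
    (hi : ∀ i, ¬ ρ.EvIn (above (i :: s))) : ρ.EvIn {p | p.1 = s ∧ p.2 ≠ 0} := by
  obtain ⟨N, hN⟩ := hs.inter (Ray.evIn_compl_of_finite (Set.finite_singleton (s, 0)) ρ)
  refine ⟨N, fun n hn => ?_⟩
  obtain ⟨h1, h2⟩ := hN n hn
  by_cases heq : (ρ.vert n).1 = s
  · refine ⟨heq, fun h0 => h2 ?_⟩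
    exact Prod.ext heq h0
  · exfalso
    obtain ⟨i, hiS⟩ := exists_cons_suffix h1 heq
    refine hi i ⟨n, fun m hm => ?_⟩
    induction m, hm using Nat.le_induction with
    | base => exact hiS
    | succ m hm ih =>
      by_contra hc
      exact (hN (m + 1) (by omega)).2 (fanTree_leave (ρ.adj m) ih hc).2

theorem term_of_evIn_fan {ρ : Ray (fanTree U)} {s : List I}
    (h : ρ.EvIn {p | p.1 = s ∧ p.2 ≠ 0}) : Term U s := by
  obtain ⟨N, hN⟩ := h
  obtain ⟨h1, h2⟩ := hN N le_rfl
  exact h1 ▸ term_of_adj_succ (ρ.adj N) h2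

theorem suffix_or_of_evIn {ρ : Ray (fanTree U)} {s t : List I} (hs : ρ.EvIn (above s))
    (ht : ρ.EvIn (above t)) : s <:+ t ∨ t <:+ s := by
  obtain ⟨x, hx, hx'⟩ := (hs.inter ht).nonempty
  exact List.suffix_or_suffix_of_suffix hx hx'

theorem exists_initSeg {P : List I → Prop} (h0 : P []) (hs : ∀ s, P s → ∃ i, P (i :: s)) :
    ∃ f : ℕ → I, ∀ n, P (initSeg f n) := by
  classical
  choose g hg using hs
  let l : ℕ → {s // P s} := fun n => Nat.rec ⟨[], h0⟩ (fun _ s => ⟨g s.1 s.2 :: s.1, hg s.1 s.2⟩) n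
  have hl : ∀ n, initSeg (fun n => g (l n).1 (l n).2) n = (l n).1 := by
    intro n
    induction n with
    | zero => rfl
    | succ n ih => rw [initSeg, ih]
  exact ⟨_, fun n => hl n ▸ (l n).2⟩

theorem Lim.of_toEdgeEnd_eq {ρ ρ' : Ray (fanTree U)} {x : X} (h : ρ.toEdgeEnd = ρ'.toEdgeEnd)
    (hx : Lim ρ x) : Lim ρ' x := fun s => (hx s).trans
  ⟨fun hr => hr.of_toEdgeEnd_eq (bd_above_finite s) h,
    fun hr => hr.of_toEdgeEnd_eq (bd_above_finite s) h.symm⟩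

/-! ### Address systems and convergence of rays in the fan tree -/

variable [TopologicalSpace X]

/-- A family of clopen sets `U s`, indexed by the nodes `s` of a tree of finite sequences (written
with the last letter first), that determines the topology of `X`. -/
structure AddressSystem (U : List I → Set X) : Prop where
  nil : U [] = Set.univ
  mono : ∀ i s, U (i :: s) ⊆ U s
  disj : ∀ {x s i j}, x ∈ U (i :: s) → x ∈ U (j :: s) → i = j
  sep : ∀ x y, (∀ s, x ∈ U s ↔ y ∈ U s) → x = y
  clopen : ∀ s, IsClopen (U s)
  base : ∀ x O, IsOpen O → x ∈ O → ∃ (s : List I) (J : Set I), J.Finite ∧ x ∈ U s ∧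
    (∀ j ∈ J, x ∉ U (j :: s)) ∧ ∀ y ∈ U s, (∀ j ∈ J, y ∉ U (j :: s)) → y ∈ O
  complete : ∀ f : ℕ → I, (∀ n, (U (initSeg f n)).Nonempty) → ∃ x, ∀ n, x ∈ U (initSeg f n)

namespace AddressSystem

variable (hU : AddressSystem U)
include hU

theorem subset_of_suffix {s t : List I} (h : s <:+ t) : U t ⊆ U s := by
  obtain ⟨l, rfl⟩ := h
  induction l with
  | nil => exact subset_rfl
  | cons i l ih => exact (hU.mono i _).trans ih

theorem eq_of_length {x : X} : ∀ {s t : List I}, x ∈ U s → x ∈ U t → s.length = t.length → s = t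
  | [], [], _, _, _ => rfl
  | [], _ :: _, _, _, h => by simp at h
  | _ :: _, [], _, _, h => by simp at h
  | i :: s, j :: t, hs, ht, h => by
    obtain rfl : s = t := eq_of_length (hU.mono _ _ hs) (hU.mono _ _ ht) (by simpa using h)
    rw [hU.disj hs ht]

theorem suffix_of_length_le {x : X} {s t : List I} (hs : x ∈ U s) (ht : x ∈ U t)
    (h : s.length ≤ t.length) : s <:+ t := by
  have h1 : (t.drop (t.length - s.length)) <:+ t := List.drop_suffix _ _
  have h2 := hU.subset_of_suffix h1 ht
  have h3 : s = t.drop (t.length - s.length) := hU.eq_of_length hs h2 (by simp; omega)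
  rw [h3]
  exact h1

theorem suffix_or {x : X} {s t : List I} (hs : x ∈ U s) (ht : x ∈ U t) : s <:+ t ∨ t <:+ s :=
  (le_total s.length t.length).imp (hU.suffix_of_length_le hs ht) (hU.suffix_of_length_le ht hs)

theorem nonempty_of_adj {a b : List I × ℕ} (h : (fanTree U).Adj a b) : (U a.1).Nonempty := by
  rcases fanTree_adj_cases h with ⟨i, h1, -, -, h4⟩ | ⟨i, h1, -, -, h4⟩ | ⟨-, x, hx, -⟩
  · rw [h1] at h4
    exact h4.mono (hU.mono _ _)
  · exact h4
  · exact ⟨x, hx⟩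

/-- A vertex above `s` reaches `s` if no edge of `F` lies above `s`. -/
theorem reachable_base {F : Set (Sym2 (List I × ℕ))} {s : List I}
    (hF : Disjoint (above s) (touch F)) {a : List I × ℕ} (ha : a ∈ above s)
    (hne : (U a.1).Nonempty) (ht : a.2 ≠ 0 → Term U a.1) :
    ((fanTree U).deleteEdges F).Reachable a (s, 0) := by
  have hedge : ∀ x y : List I × ℕ, (fanTree U).Adj x y → x ∈ above s →
      ((fanTree U).deleteEdges F).Reachable y x := by
    intro x y hxy hx
    refine SimpleGraph.Adj.reachable (SimpleGraph.Adj.symm ?_)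
    rw [SimpleGraph.deleteEdges_adj]
    exact ⟨hxy, fun he => Set.disjoint_left.1 hF hx (left_mem_touch he)⟩
  obtain ⟨t, k⟩ := a
  have h0 : ((fanTree U).deleteEdges F).Reachable (t, k) (t, 0) := by
    cases k with
    | zero => exact SimpleGraph.Reachable.refl _
    | succ k => exact hedge _ _ (fanTree_adj_zero (ht (by simp)) k) ha
  refine h0.trans ?_
  obtain ⟨l, rfl⟩ := ha
  clear h0 ht
  induction l with
  | nil => exact SimpleGraph.Reachable.refl _
  | cons i l ih =>
    exact (hedge _ _ (fanTree_adj_cons hne) (List.suffix_append _ _)).trans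
      (ih (hne.mono (hU.mono _ _)))

theorem ray_reachable_base {F : Set (Sym2 (List I × ℕ))} {s : List I}
    (hF : Disjoint (above s) (touch F)) (ρ : Ray (fanTree U)) {n : ℕ} (h : ρ.vert n ∈ above s) :
    ((fanTree U).deleteEdges F).Reachable (ρ.vert n) (s, 0) :=
  hU.reachable_base hF h (hU.nonempty_of_adj (ρ.adj n)) (term_of_adj_succ (ρ.adj n))

theorem nonempty_of_evIn {ρ : Ray (fanTree U)} {s : List I} (h : ρ.EvIn (above s)) :
    (U s).Nonempty := by
  obtain ⟨N, hN⟩ := h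
  exact (hU.nonempty_of_adj (ρ.adj N)).mono (hU.subset_of_suffix (hN N le_rfl))

/-- Both the point and the ray have an address that stops at `s`, so each belongs to exactly the
nodes that are suffixes of `s`. -/
theorem lim_of_term {ρ : Ray (fanTree U)} {x : X} {s : List I} (hs : ρ.EvIn (above s))
    (hi : ∀ i, ¬ ρ.EvIn (above (i :: s))) (hx : x ∈ U s) (hxi : ∀ i, x ∉ U (i :: s)) :
    Lim ρ x := by
  intro t
  constructor
  · intro ht
    rcases hU.suffix_or hx ht with h | h
    · by_cases heq : t = s
      · exact heq ▸ hs
      · obtain ⟨i, h'⟩ := exists_cons_suffix h heq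
        exact absurd (hU.subset_of_suffix h' ht) (hxi i)
    · exact hs.mono fun p hp => h.trans hp
  · intro ht
    rcases suffix_or_of_evIn hs ht with h | h
    · by_cases heq : t = s
      · exact heq ▸ hx
      · obtain ⟨i, h'⟩ := exists_cons_suffix h heq
        exact absurd (ht.mono fun p hp => h'.trans hp) (hi i)
    · exact hU.subset_of_suffix h hx

theorem lim_of_initSeg {ρ : Ray (fanTree U)} {x : X} {f : ℕ → I}
    (hρ : ∀ n, ρ.EvIn (above (initSeg f n))) (hx : ∀ n, x ∈ U (initSeg f n)) : Lim ρ x := by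
  intro t
  constructor
  · intro ht
    have := hU.eq_of_length ht (hx t.length) (length_initSeg f _).symm
    exact this ▸ hρ _
  · intro ht
    rcases suffix_or_of_evIn ht (hρ t.length) with h | h
    · exact hU.subset_of_suffix h (hx _)
    · rw [← h.eq_of_length (length_initSeg f _)]
      exact hx _

/-- The address of a ray either stops at a node, where the ray runs into a fan and `Term` supplies
the point, or is an infinite branch, where `complete` does. -/
theorem exists_lim (ρ : Ray (fanTree U)) : ∃ x, Lim ρ x := by
  by_cases hfin : ∃ s, ρ.EvIn (above s) ∧ ∀ i, ¬ ρ.EvIn (above (i :: s))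
  · obtain ⟨s, hs, hi⟩ := hfin
    obtain ⟨x, hx, hxi⟩ := term_of_evIn_fan (evIn_fan hs hi)
    exact ⟨x, hU.lim_of_term hs hi hx hxi⟩
  · push Not at hfin
    obtain ⟨f, hf⟩ := exists_initSeg (P := fun s => ρ.EvIn (above s))
      ⟨0, fun n _ => List.nil_suffix⟩ hfin
    obtain ⟨x, hx⟩ := hU.complete f fun n => hU.nonempty_of_evIn (hf n)
    exact ⟨x, hU.lim_of_initSeg hf hx⟩

theorem lim_unique {ρ : Ray (fanTree U)} {x y : X} (hx : Lim ρ x) (hy : Lim ρ y) : x = y :=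
  hU.sep x y fun s => (hx s).trans (hy s).symm

theorem exists_ray (x : X) : ∃ ρ : Ray (fanTree U), Lim ρ x := by
  by_cases hfin : ∃ s, x ∈ U s ∧ ∀ i, x ∉ U (i :: s)
  · obtain ⟨s, hs, hi⟩ := hfin
    refine ⟨⟨fun n => (s, n), fun m n h => by simpa using h,
      fun n => fanTree_adj_succ ⟨x, hs, hi⟩ n⟩, hU.lim_of_term ⟨0, fun n _ => List.suffix_rfl⟩ ?_
      hs hi⟩
    rintro i ⟨N, hN⟩
    have := (hN N le_rfl).length_le
    simp at this
  · push Not at hfin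
    obtain ⟨f, hf⟩ := exists_initSeg (P := fun s => x ∈ U s) (by simp [hU.nil]) hfin
    refine ⟨⟨fun n => (initSeg f n, 0), fun m n h => ?_,
      fun n => fanTree_adj_cons ⟨x, hf (n + 1)⟩⟩, hU.lim_of_initSeg (fun n => ⟨n, fun m hm => ?_⟩) hf⟩
    · have := congrArg (fun p : List I × ℕ => p.1.length) h
      simpa [length_initSeg] using this
    · exact hU.suffix_of_length_le (hf n) (hf m) (by simpa [length_initSeg] using hm)

/-- Rays converging to points near `x` are not separated by a given finite set of edges. -/
theorem exists_nhd (x : X) {F : Set (Sym2 (List I × ℕ))} (hF : F.Finite) :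
    ∃ O, IsOpen O ∧ x ∈ O ∧ ∃ a, ∀ y ∈ O, ∀ ρ : Ray (fanTree U), Lim ρ y →
      ∃ N, ∀ n ≥ N, ((fanTree U).deleteEdges F).Reachable (ρ.vert n) a := by
  have hfinT := touch_finite hF
  by_cases hfin : ∃ s, x ∈ U s ∧ ∀ i, x ∉ U (i :: s)
  · obtain ⟨s, hs, hi⟩ := hfin
    -- The children whose upper part is touched by `F`. There are finitely many, since a vertex lies
    -- above at most one child of `s`. Everything above another child remains connected to `(s, 0)`.
    let J : Set I := {j | ¬ Disjoint (above (j :: s)) (touch F)}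
    have hJ : J.Finite := by
      have hsub : J ⊆ ⋃ v ∈ touch F, {j | v ∈ above (j :: s)} := by
        intro j hj
        obtain ⟨v, hv, hv'⟩ := Set.not_disjoint_iff.1 hj
        exact Set.mem_biUnion hv' hv
      refine (hfinT.biUnion fun v _ => Set.Subsingleton.finite ?_).subset hsub
      intro i hi j hj
      have h := List.suffix_or_suffix_of_suffix (show i :: s <:+ v.1 from hi)
        (show j :: s <:+ v.1 from hj)
      rcases h with h | h
      · simpa using h.eq_of_length (by simp)
      · simpa using (h.eq_of_length (by simp)).symm
    refine ⟨U s ∩ ⋂ j ∈ J, (U (j :: s))ᶜ, (hU.clopen s).isOpen.inter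
      (hJ.isOpen_biInter fun j _ => (hU.clopen _).compl.isOpen), ⟨hs, by simpa using fun j _ => hi j⟩,
      (s, 0), ?_⟩
    rintro y ⟨hy, hyJ⟩ ρ hρ
    simp only [Set.mem_iInter, Set.mem_compl_iff] at hyJ
    by_cases hyi : ∃ i, y ∈ U (i :: s)
    · obtain ⟨i, hyi⟩ := hyi
      have hiJ : Disjoint (above (i :: s)) (touch F) := by
        by_contra hc
        exact hyJ i hc hyi
      obtain ⟨N, hN⟩ := (hρ _).1 hyi
      refine ⟨N, fun n hn => (hU.ray_reachable_base hiJ ρ (hN n hn)).trans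
        (SimpleGraph.Adj.reachable (SimpleGraph.Adj.symm ?_))⟩
      rw [SimpleGraph.deleteEdges_adj]
      exact ⟨fanTree_adj_cons ⟨y, hyi⟩, fun he => Set.disjoint_left.1 hiJ
        (show ((i :: s, 0) : List I × ℕ) ∈ above (i :: s) from List.suffix_rfl)
        (right_mem_touch he)⟩
    · push Not at hyi
      have hfan := evIn_fan ((hρ s).1 hy) fun i hc => hyi i ((hρ _).2 hc)
      obtain ⟨N, hN⟩ := hfan.inter (Ray.evIn_compl_of_finite hfinT ρ)
      refine ⟨N, fun n hn => ?_⟩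
      obtain ⟨⟨h1, h2⟩, h3⟩ := hN n hn
      refine SimpleGraph.Adj.reachable (SimpleGraph.Adj.symm ?_)
      rw [SimpleGraph.deleteEdges_adj]
      refine ⟨?_, fun he => h3 (right_mem_touch he)⟩
      obtain ⟨k, hk⟩ := Nat.exists_eq_succ_of_ne_zero h2
      have : ρ.vert n = (s, k + 1) := Prod.ext h1 hk
      rw [this]
      exact fanTree_adj_zero (term_of_evIn_fan hfan) k
  · push Not at hfin
    obtain ⟨f, hf⟩ := exists_initSeg (P := fun s => x ∈ U s) (by simp [hU.nil]) hfin
    -- Beyond the depth `K` of all vertices touched by `F`, the tree is intact.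
    obtain ⟨K, hK⟩ := (hfinT.image fun p => p.1.length).bddAbove
    have hdis : Disjoint (above (initSeg f (K + 1))) (touch F) := by
      rw [Set.disjoint_left]
      intro p hp hpF
      have h1 := hK (Set.mem_image_of_mem _ hpF)
      have h2 := List.IsSuffix.length_le hp
      rw [length_initSeg] at h2
      omega
    refine ⟨U (initSeg f (K + 1)), (hU.clopen _).isOpen, hf _, (initSeg f (K + 1), 0), ?_⟩
    intro y hy ρ hρ
    obtain ⟨N, hN⟩ := (hρ _).1 hy
    exact ⟨N, fun n hn => hU.ray_reachable_base hdis ρ (hN n hn)⟩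

theorem toEdgeEnd_eq {ρ ρ' : Ray (fanTree U)} {x : X} (h : Lim ρ x) (h' : Lim ρ' x) :
    ρ.toEdgeEnd = ρ'.toEdgeEnd := by
  rw [toEdgeEnd_eq_iff]
  intro F _ hF
  obtain ⟨O, -, hx, a, ha⟩ := hU.exists_nhd x hF
  obtain ⟨N, hN⟩ := ha x hx ρ h
  obtain ⟨M, hM⟩ := ha x hx ρ' h'
  exact not_not.2 ⟨max N M, fun m hm n hn => (hN m (le_trans (le_max_left _ _) hm)).trans
    (hM n (le_trans (le_max_right _ _) hn)).symm⟩

end AddressSystem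

/-- The finitely many boundary edges form an admissible separator, and rays it does not separate lie
on the same side. -/
theorem isOpen_edgeEnds_evIn {V : Type u} {H : SimpleGraph V} {A : Set V} (hA : (bd H A).Finite) :
    IsOpen {ξ : EdgeEnds H | ∃ ρ : Ray H, ρ.toEdgeEnd = ξ ∧ ρ.EvIn A} := by
  have : {ξ : EdgeEnds H | ∃ ρ : Ray H, ρ.toEdgeEnd = ξ ∧ ρ.EvIn A} =
      ⋃ (ρ : Ray H) (_ : ρ.EvIn A), edgeEndNhd (bd H A) ρ := by
    ext ξ
    simp only [Set.mem_ofPred_eq, Set.mem_iUnion, edgeEndNhd]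
    constructor
    · rintro ⟨ρ, rfl, hρ⟩
      exact ⟨ρ, hρ, ρ, rfl, toEdgeEnd_eq_iff.1 rfl _ (bd_subset_edgeSet A) hA⟩
    · rintro ⟨ρ, hρ, σ, rfl, hs⟩
      exact ⟨σ, rfl, hρ.of_not_edgeSeparates subset_rfl hs⟩
  rw [this]
  exact isOpen_iUnion fun ρ => isOpen_iUnion fun _ =>
    TopologicalSpace.isOpen_generateFrom_of_mem ⟨_, ρ, bd_subset_edgeSet A, hA, rfl⟩

/-- A space with an address system is homeomorphic to the edge-end space of its fan tree. -/
theorem AddressSystem.exists_homeomorph (hU : AddressSystem U) :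
    Nonempty (EdgeEnds (fanTree U) ≃ₜ X) := by
  classical
  choose lim hlim using hU.exists_lim
  choose ray hray using hU.exists_ray
  have hlim' : ∀ ρ x, Lim ρ x → lim ρ = x := fun ρ x h => hU.lim_unique (hlim ρ) h
  let Φ : EdgeEnds (fanTree U) → X := Quotient.lift lim fun ρ ρ' h =>
    (hlim' ρ' _ (Lim.of_toEdgeEnd_eq (Quotient.sound h) (hlim ρ))).symm
  have hΦ : ∀ ρ : Ray (fanTree U), Φ ρ.toEdgeEnd = lim ρ := fun ρ => rfl
  have hsurj : ∀ ξ : EdgeEnds (fanTree U), ∃ ρ : Ray (fanTree U), ρ.toEdgeEnd = ξ :=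
    fun ξ => Quotient.exists_rep ξ
  let e : EdgeEnds (fanTree U) ≃ X :=
    { toFun := Φ
      invFun := fun x => (ray x).toEdgeEnd
      left_inv := by
        intro ξ
        obtain ⟨ρ, rfl⟩ := hsurj ξ
        exact hU.toEdgeEnd_eq (hray _) (hlim ρ)
      right_inv := fun x => hlim' _ _ (hray x) }
  have hpre : ∀ s, Φ ⁻¹' U s = {ξ | ∃ ρ : Ray (fanTree U), ρ.toEdgeEnd = ξ ∧ ρ.EvIn (above s)} := by
    intro s
    ext ξ
    constructor
    · intro h
      obtain ⟨ρ, rfl⟩ := hsurj ξ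
      exact ⟨ρ, rfl, (hlim ρ s).1 h⟩
    · rintro ⟨ρ, rfl, h⟩
      exact (hlim ρ s).2 h
  have hopen : ∀ s, IsOpen (Φ ⁻¹' U s) := fun s => hpre s ▸ isOpen_edgeEnds_evIn (bd_above_finite s)
  have hopenc : ∀ s, IsOpen (Φ ⁻¹' (U s)ᶜ) := by
    intro s
    have : Φ ⁻¹' (U s)ᶜ =
        {ξ | ∃ ρ : Ray (fanTree U), ρ.toEdgeEnd = ξ ∧ ρ.EvIn (above s)ᶜ} := by
      ext ξ
      constructor
      · intro h
        obtain ⟨ρ, rfl⟩ := hsurj ξ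
        exact ⟨ρ, rfl, (Ray.evIn_or_compl (bd_above_finite s) ρ).resolve_left fun hc =>
          h ((hlim ρ s).2 hc)⟩
      · rintro ⟨ρ, rfl, h⟩ hc
        exact ((hlim ρ s).1 hc).not_compl h
    rw [this]
    exact isOpen_edgeEnds_evIn (by rw [bd_compl]; exact bd_above_finite s)
  have hcont : Continuous Φ := by
    rw [continuous_def]
    intro O hO
    rw [isOpen_iff_forall_mem_open]
    intro ξ hξ
    obtain ⟨s, J, hJ, hs, hj, hsub⟩ := hU.base _ O hO hξ
    refine ⟨Φ ⁻¹' U s ∩ ⋂ j ∈ J, Φ ⁻¹' (U (j :: s))ᶜ, ?_, (hopen s).inter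
      (hJ.isOpen_biInter fun j _ => hopenc _), ⟨hs, by simpa using hj⟩⟩
    rintro η ⟨h1, h2⟩
    exact hsub _ h1 (by simpa using h2)
  have hcont' : Continuous e.symm := by
    refine continuous_generateFrom_iff.2 ?_
    rintro _ ⟨F, ρ, hFG, hF, rfl⟩
    rw [isOpen_iff_forall_mem_open]
    intro x hx
    obtain ⟨ρ', hρ', hns⟩ := hx
    have hl : Lim ρ' x := Lim.of_toEdgeEnd_eq hρ'.symm (hray x)
    obtain ⟨O, hO, hxO, a, ha⟩ := hU.exists_nhd x hF
    refine ⟨O, fun y hy => ⟨ray y, rfl, not_edgeSeparates_trans hns ?_⟩, hO, hxO⟩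
    obtain ⟨N, hN⟩ := ha x hxO ρ' hl
    obtain ⟨M, hM⟩ := ha y hy (ray y) (hray y)
    exact not_not.2 ⟨max N M, fun m hm n hn => (hN m (le_trans (le_max_left _ _) hm)).trans
      (hM n (le_trans (le_max_right _ _) hn)).symm⟩
  exact ⟨{ e with continuous_toFun := hcont, continuous_invFun := hcont' }⟩

end AddressTree

/-! ### Constructing rays -/

/-- Inside a connected set, one can approach a given target set step by step. -/
theorem exists_rank {A T : Set V} (hA : ConnSet G A) (hT : (A ∩ T).Nonempty) :
    ∃ d : V → ℕ, ∀ v ∈ A, v ∉ T → ∃ w ∈ A, G.Adj v w ∧ d w < d v := by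
  classical
  obtain ⟨t, htA, htT⟩ := hT
  -- The rank of `v` is the length of a shortest walk inside `A` from `v` to `T`.
  let P : V → ℕ → Prop := fun v n =>
    ∃ (t : V) (p : G.Walk v t), t ∈ T ∧ (∀ x ∈ p.support, x ∈ A) ∧ p.length = n
  refine ⟨fun v => sInf {n | P v n}, fun v hv hvT => ?_⟩
  have hne : {n | P v n}.Nonempty := by
    obtain ⟨p, hp⟩ := hA v hv t htA
    exact ⟨_, t, p, htT, fun x hx => not_not.1 (hp x hx), rfl⟩
  obtain ⟨t', p, ht', hp, hlen⟩ := Nat.sInf_mem hne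
  cases p with
  | nil => exact absurd ht' hvT
  | @cons _ w _ hadj q =>
    refine ⟨w, hp w (by simp), hadj, ?_⟩
    have hw : P w q.length := ⟨t', q, ht', fun x hx => hp x (by simp [hx]), rfl⟩
    have h1 : sInf {n | P w n} ≤ q.length := Nat.sInf_le hw
    rw [SimpleGraph.Walk.length_cons] at hlen
    show sInf {n | P w n} < sInf {n | P v n}
    omega

/-- A decreasing sequence of connected sets with empty intersection captures a ray. -/
theorem exists_ray_of_chain {A : ℕ → Set V} (hanti : ∀ n, A (n + 1) ⊆ A n)
    (hne : ∀ n, (A n).Nonempty) (hconn : ∀ n, ConnSet G (A n)) (hemp : ∀ v, ∃ n, v ∉ A n) :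
    ∃ r : Ray G, ∀ n, r.EvIn (A n) := by
  classical
  have hA : Antitone A := antitone_nat_of_succ_le hanti
  have hd : ∀ n, ∃ d : V → ℕ, ∀ v ∈ A n, v ∉ A (n + 1) → ∃ w ∈ A n, G.Adj v w ∧ d w < d v :=
    fun n => exists_rank (hconn n) ((hne (n + 1)).mono fun x hx => ⟨hanti n hx, hx⟩)
  choose d hd using hd
  -- `h v` will be the last index whose set contains `v`. The ray always moves inside `A (h v)`
  -- towards `A (h v + 1)`.
  have hh : ∀ v ∈ A 0, ∃ n, v ∈ A n ∧ v ∉ A (n + 1) := by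
    intro v hv
    have h0 : Nat.find (hemp v) ≠ 0 := fun h => Nat.find_spec (hemp v) (h ▸ hv)
    obtain ⟨n, hn⟩ := Nat.exists_eq_succ_of_ne_zero h0
    exact ⟨n, not_not.1 (Nat.find_min (hemp v) (by omega)), by
      have := Nat.find_spec (hemp v)
      rwa [hn] at this⟩
  choose! h hin hout using hh
  have hle : ∀ v ∈ A 0, ∀ n, v ∈ A n → n ≤ h v := by
    intro v hv n hn
    by_contra hc
    exact hout v hv (hA (by omega) hn)
  have hnext : ∀ v ∈ A 0, ∃ w ∈ A (h v), G.Adj v w ∧ d (h v) w < d (h v) v :=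
    fun v hv => hd _ v (hin v hv) (hout v hv)
  choose! next hnA hadj hlt using hnext
  obtain ⟨v0, hv0⟩ := hne 0
  let c : ℕ → V := fun n => next^[n] v0
  have hcs : ∀ n, c (n + 1) = next (c n) := fun n => Function.iterate_succ_apply' _ _ _
  have hc0 : ∀ n, c n ∈ A 0 := by
    intro n
    induction n with
    | zero => exact hv0
    | succ n ih => rw [hcs]; exact hA (Nat.zero_le _) (hnA _ ih)
  -- Lexicographic progress: either the index `h` grows, or it stays and the distance to the next
  -- set drops. Hence no vertex is repeated.
  let R : V → V → Prop := fun a b => h a < h b ∨ (h a = h b ∧ d (h b) b < d (h a) a)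
  have hstep : ∀ n, R (c n) (c (n + 1)) := by
    intro n
    rw [hcs]
    have h1 := hle _ (hcs n ▸ hc0 (n + 1)) _ (hnA _ (hc0 n))
    rcases h1.lt_or_eq with h2 | h2
    · exact Or.inl h2
    · refine Or.inr ⟨h2, ?_⟩
      have := hlt _ (hc0 n)
      rw [← h2]
      exact this
  have hR : ∀ i k, R (c i) (c (i + k + 1)) := by
    intro i k
    induction k with
    | zero => exact hstep i
    | succ k ih =>
      have h2 := hstep (i + k + 1)
      rcases ih with h3 | ⟨h3, h3'⟩ <;> rcases h2 with h4 | ⟨h4, h4'⟩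
      · exact Or.inl (h3.trans h4)
      · exact Or.inl (h4 ▸ h3)
      · exact Or.inl (h3 ▸ h4)
      · exact Or.inr ⟨h3.trans h4, h4'.trans h3'⟩
  have hne' : ∀ i j, i < j → c i ≠ c j := by
    intro i j hij heq
    obtain ⟨k, rfl⟩ := Nat.exists_eq_add_of_lt hij
    rcases hR i k with h1 | ⟨-, h1⟩ <;> rw [heq] at h1 <;> exact lt_irrefl _ h1
  have hmono : ∀ n m, n ≤ m → h (c n) ≤ h (c m) := by
    intro n m hnm
    rcases hnm.lt_or_eq with h1 | rfl
    · obtain ⟨k, rfl⟩ := Nat.exists_eq_add_of_lt h1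
      rcases hR n k with h2 | ⟨h2, -⟩
      exacts [h2.le, h2.le]
    · rfl
  refine ⟨⟨c, fun i j hij => ?_, fun n => ?_⟩, fun n => ?_⟩
  · by_contra hc
    rcases Nat.lt_or_gt_of_ne hc with h1 | h1
    exacts [hne' _ _ h1 hij, hne' _ _ h1 hij.symm]
  · rw [hcs]; exact hadj _ (hc0 n)
  · show ∃ N, ∀ k ≥ N, c k ∈ A n
    suffices hs : ∃ N, n ≤ h (c N) by
      obtain ⟨N, hN⟩ := hs
      exact ⟨N, fun k hk => hA (hN.trans (hmono _ _ hk)) (hin _ (hc0 k))⟩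
    induction n with
    | zero => exact ⟨0, Nat.zero_le _⟩
    | succ n ih =>
      obtain ⟨N, hN⟩ := ih
      -- While `h` remains equal to `n`, the rank `d n` strictly decreases, so `h` must exceed `n`
      -- eventually. The induction is on a bound for that rank.
      have key : ∀ D k, N ≤ k → d n (c k) ≤ D → ∃ j, n + 1 ≤ h (c j) := by
        intro D
        induction D with
        | zero =>
          intro k hk hD
          by_contra! hcon
          have e1 : h (c k) = n := by have := hmono _ _ hk; have := hcon k; omega
          have := hlt _ (hc0 k)
          rw [e1] at this
          omega
        | succ D ihD =>
          intro k hk hD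
          by_contra! hcon
          have e1 : h (c k) = n := by have := hmono _ _ hk; have := hcon k; omega
          have := hlt _ (hc0 k)
          rw [e1, ← hcs] at this
          obtain ⟨j, hj⟩ := ihD (k + 1) (by omega) (by omega)
          have := hcon j
          omega
      exact key _ N le_rfl le_rfl

/-- The vertices that no finite set of edges separates from `m`. -/
def edgeBlock (G : SimpleGraph V) (m : V) : Set V :=
  {v | ∀ F : Set (Sym2 V), F.Finite → (G.deleteEdges F).Reachable m v}

theorem self_mem_edgeBlock (m : V) : m ∈ edgeBlock G m := fun _ _ => SimpleGraph.Reachable.refl _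

/-- A star-comb lemma: if infinitely many edges join a connected set to the edge-block of `m`
outside it, then the set contains a ray edge-dominated by `m`. -/
theorem exists_ray_edgeDominates {m : V} {K : Set V} (hK : ConnSet G K)
    (hKB : Disjoint K (edgeBlock G m))
    (hinf : {e | ∃ x ∈ K, ∃ y ∈ edgeBlock G m, G.Adj x y ∧ e = s(x, y)}.Infinite) :
    ∃ r : Ray G, (∀ n, r.vert n ∈ K) ∧ EdgeDominates m r := by
  classical
  set B := edgeBlock G m with hB
  let U : Set V := {x | x ∈ K ∧ ∃ y ∈ B, G.Adj x y}
  have hsep : ∀ x ∈ K, ∃ F : Set (Sym2 V), F.Finite ∧ ¬ (G.deleteEdges F).Reachable m x := by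
    intro x hx
    have : x ∉ B := Set.disjoint_left.1 hKB hx
    simpa [hB, edgeBlock] using this
  -- A finite edge set separating `x` from `m` must contain all edges from `x` to the block, so each
  -- `x` in `K` sends only finitely many edges there.
  have hUinf : U.Infinite := by
    intro hfin
    choose! F hF hF' using hsep
    refine hinf ((hfin.biUnion fun x hx => hF x hx.1).subset ?_)
    rintro _ ⟨x, hx, y, hy, hxy, rfl⟩
    refine Set.mem_biUnion (show x ∈ U from ⟨hx, y, hy, hxy⟩) ?_
    by_contra hc
    refine hF' x hx ((hy _ (hF x hx)).trans (SimpleGraph.Adj.reachable ?_))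
    rw [SimpleGraph.deleteEdges_adj]
    exact ⟨hxy.symm, by rwa [Sym2.eq_swap]⟩
  obtain ⟨y0, hy0, -⟩ := hUinf.nonempty
  -- The rank gives a spanning tree of `K` with root `y0`: `par` moves one step closer to the root
  -- and fixes the root itself; `desc c` is the subtree above `c`.
  obtain ⟨d, hd⟩ := exists_rank (T := {y0}) hK ⟨y0, hy0, rfl⟩
  have hpar : ∀ v, ∃ w, (v ∈ K → w ∈ K) ∧ d w ≤ d v ∧ (v = y0 → w = y0) ∧
      (v ∈ K → v ≠ y0 → G.Adj v w ∧ d w < d v) := by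
    intro v
    by_cases hv : v ∈ K ∧ v ≠ y0
    · obtain ⟨w, hw, hadj, hlt⟩ := hd v hv.1 hv.2
      exact ⟨w, fun _ => hw, hlt.le, fun h => absurd h hv.2, fun _ _ => ⟨hadj, hlt⟩⟩
    · exact ⟨v, id, le_rfl, id, fun h h' => absurd ⟨h, h'⟩ hv⟩
  choose par hparK hparle hpar0 hpar using hpar
  have hitle : ∀ k v, d (par^[k] v) ≤ d v := by
    intro k
    induction k with
    | zero => exact fun v => le_rfl
    | succ k ih => exact fun v => (ih (par v)).trans (hparle v)
  let desc : V → Set V := fun c => {v | v ∈ K ∧ ∃ k, par^[k] v = c}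
  have hdle : ∀ c, ∀ v ∈ desc c, d c ≤ d v := by
    rintro c v ⟨-, k, rfl⟩
    exact hitle k v
  have hself : ∀ c ∈ K, c ∈ desc c := fun c hc => ⟨hc, 0, rfl⟩
  have hdesc0 : ∀ n, ∀ v ∈ K, d v ≤ n → v ∈ desc y0 := by
    intro n
    induction n with
    | zero =>
      intro v hv hn
      by_cases h : v = y0
      · exact ⟨hv, 0, h⟩
      · have := (hpar v hv h).2
        omega
    | succ n ih =>
      intro v hv hn
      by_cases h : v = y0
      · exact ⟨hv, 0, h⟩
      · obtain ⟨-, k, hk⟩ := ih (par v) (hparK v hv) (by have := (hpar v hv h).2; omega)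
        exact ⟨hv, k + 1, hk⟩
  have hitK : ∀ k, ∀ v ∈ K, par^[k] v ∈ K := by
    intro k
    induction k with
    | zero => exact fun v hv => hv
    | succ k ih => exact fun v hv => ih _ (hparK v hv)
  have hchild : ∀ c, ∀ v ∈ desc c, v = c ∨ ∃ c', c' ∈ K ∧ c' ≠ y0 ∧ par c' = c ∧ v ∈ desc c' := by
    rintro c v ⟨hv, hk⟩
    cases hk' : Nat.find hk with
    | zero =>
      have := Nat.find_spec hk
      rw [hk'] at this
      exact Or.inl this
    | succ k =>
      right
      have h1 := Nat.find_spec hk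
      rw [hk', Function.iterate_succ_apply'] at h1
      refine ⟨par^[k] v, hitK k v hv, fun h0 => ?_, h1, hv, k, rfl⟩
      refine Nat.find_min hk (m := k) (by omega) ?_
      rw [← h1, hpar0 _ h0, h0]
  have hdisj : ∀ c' c'' v, c' ≠ y0 → c'' ≠ y0 → c' ∈ K → c'' ∈ K → par c' = par c'' →
      v ∈ desc c' → v ∈ desc c'' → c' = c'' := by
    have aux : ∀ c' c'' v k l, c'' ≠ y0 → c'' ∈ K → par c' = par c'' → par^[k] v = c' →
        par^[l] v = c'' → k ≤ l → c' = c'' := by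
      intro c' c'' v k l h0 hK'' hp hk hl hkl
      obtain ⟨j, rfl⟩ := Nat.exists_eq_add_of_le hkl
      cases j with
      | zero => exact hk.symm.trans hl
      | succ j =>
        exfalso
        have e1 : par^[j + 1] c' = c'' := by
          rw [← hk, ← Function.iterate_add_apply, add_comm]
          exact hl
        rw [Function.iterate_succ_apply, hp] at e1
        have h2 := hitle j (par c'')
        rw [e1] at h2
        have := (hpar c'' hK'' h0).2
        omega
    rintro c' c'' v h0' h0'' hK' hK'' hp ⟨-, k, hk⟩ ⟨-, l, hl⟩
    rcases le_total k l with h | h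
    · exact aux c' c'' v k l h0'' hK'' hp hk hl h
    · exact (aux c'' c' v l k h0' hK' hp.symm hl hk h).symm
  -- If `F` misses the subtree above `c`, then `m` reaches `c` through the block, across an edge to
  -- a vertex of `U` in the subtree, and down the tree.
  have hreach : ∀ (F : Set (Sym2 V)) (c : V), F.Finite → Disjoint (desc c) (touch F) →
      (desc c ∩ U).Nonempty → (G.deleteEdges F).Reachable m c := by
    rintro F c hF hdis ⟨u, ⟨huK, k, hk⟩, -, b, hb, hub⟩
    have h1 : (G.deleteEdges F).Reachable m u := by
      refine (hb F hF).trans (SimpleGraph.Adj.reachable ?_)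
      rw [SimpleGraph.deleteEdges_adj]
      exact ⟨hub.symm, fun he => Set.disjoint_left.1 hdis ⟨huK, k, hk⟩ (right_mem_touch he)⟩
    clear hub
    induction k generalizing u with
    | zero => exact hk ▸ h1
    | succ k ih =>
      by_cases h0 : u = y0
      · exact ih u huK (by rw [Function.iterate_succ_apply, hpar0 _ h0] at hk; rw [h0]; exact hk) h1
      · refine ih (par u) (hparK u huK) hk (h1.trans (SimpleGraph.Adj.reachable ?_))
        rw [SimpleGraph.deleteEdges_adj]
        exact ⟨(hpar u huK h0).1, fun he => Set.disjoint_left.1 hdis ⟨huK, k + 1, hk⟩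
          (left_mem_touch he)⟩
  let Ch : V → Set V := fun c => {c' | c' ∈ K ∧ c' ≠ y0 ∧ par c' = c ∧ (desc c' ∩ U).Nonempty}
  -- With infinitely many such children, any finite `F` misses the subtree above one of them, so `m`
  -- still reaches `c`. Then `c` would lie in the block.
  have hChfin : ∀ c ∈ K, (Ch c).Finite := by
    intro c hc
    by_contra hinfC
    refine Set.disjoint_left.1 hKB hc fun F hF => ?_
    have hfinT := touch_finite hF
    have hbad : {c' ∈ Ch c | ¬ Disjoint (desc c') (touch F)}.Finite := by
      refine (hfinT.biUnion (t := fun v => {c' ∈ Ch c | v ∈ desc c'}) fun v _ =>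
        Set.Subsingleton.finite ?_).subset ?_
      · rintro a ⟨⟨ha1, ha2, ha3, -⟩, ha⟩ b ⟨⟨hb1, hb2, hb3, -⟩, hb⟩
        exact hdisj a b v ha2 hb2 ha1 hb1 (ha3.trans hb3.symm) ha hb
      · rintro c' ⟨hc', hnd⟩
        obtain ⟨v, hv, hv'⟩ := Set.not_disjoint_iff.1 hnd
        exact Set.mem_biUnion hv' ⟨hc', hv⟩
    obtain ⟨c', hc', hgood⟩ := (Set.Infinite.sdiff hinfC hbad).nonempty
    have hdis : Disjoint (desc c') (touch F) := by
      by_contra h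
      exact hgood ⟨hc', h⟩
    refine (hreach F c' hF hdis hc'.2.2.2).trans (SimpleGraph.Adj.reachable ?_)
    rw [SimpleGraph.deleteEdges_adj]
    refine ⟨?_, fun he => Set.disjoint_left.1 hdis (hself c' hc'.1) (left_mem_touch he)⟩
    have := (hpar c' hc'.1 hc'.2.1).1
    rwa [hc'.2.2.1] at this
  -- König's argument: a subtree with infinitely many vertices of `U` has a child subtree with the
  -- same property.
  have hnext : ∀ c : {c // c ∈ K ∧ (desc c ∩ U).Infinite},
      ∃ c' : {c // c ∈ K ∧ (desc c ∩ U).Infinite}, c'.1 ≠ y0 ∧ par c'.1 = c.1 := by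
    rintro ⟨c, hc, hcinf⟩
    by_contra! hcon
    refine hcinf (((Set.finite_singleton c).union ((hChfin c hc).biUnion
      (t := fun c' => desc c' ∩ U) fun c' hc' => ?_)).subset ?_)
    · by_contra h
      exact hcon ⟨c', hc'.1, h⟩ hc'.2.1 hc'.2.2.1
    · rintro v ⟨hv, hvU⟩
      rcases hchild c v hv with h | ⟨c', h1, h2, h3, h4⟩
      · exact Or.inl h
      · exact Or.inr (Set.mem_biUnion (show c' ∈ Ch c from ⟨h1, h2, h3, v, h4, hvU⟩) ⟨h4, hvU⟩)
  choose next hn0 hnpar using hnext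
  have hstart : (desc y0 ∩ U).Infinite := by
    have : desc y0 ∩ U = U := Set.inter_eq_right.2 fun v hv => hdesc0 _ v hv.1 le_rfl
    rwa [this]
  let c : ℕ → {c // c ∈ K ∧ (desc c ∩ U).Infinite} := fun n => next^[n] ⟨y0, hy0, hstart⟩
  have hcs : ∀ n, c (n + 1) = next (c n) := fun n => Function.iterate_succ_apply' _ _ _
  have hadj : ∀ n, G.Adj (c (n + 1)).1 (c n).1 ∧ d (c n).1 < d (c (n + 1)).1 := by
    intro n
    have h1 := hpar (c (n + 1)).1 (c (n + 1)).2.1 (by rw [hcs]; exact hn0 _)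
    have h2 : par (c (n + 1)).1 = (c n).1 := by rw [hcs]; exact hnpar _
    rwa [h2] at h1
  have hmono : StrictMono fun n => d (c n).1 := strictMono_nat_of_lt_succ fun n => (hadj n).2
  refine ⟨⟨fun n => (c n).1, fun i j hij => hmono.injective (congrArg d hij),
    fun n => (hadj n).1.symm⟩, fun n => (c n).2.1, fun F _ hF => ?_⟩
  -- The rank on the subtree above `c n` is at least `n`, so from `D + 1` on these subtrees miss
  -- `F`.
  obtain ⟨D, hD⟩ := ((touch_finite hF).image d).bddAbove
  refine ⟨D + 1, fun n hn => hreach F _ hF ?_ (c n).2.2.nonempty⟩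
  rw [Set.disjoint_left]
  intro v hv hvF
  have h1 : d (c n).1 ≤ d v := hdle _ v hv
  have h2 := hD (Set.mem_image_of_mem d hvF)
  have h3 : n ≤ d (c n).1 := hmono.id_le n
  omega

/-! ### Mixed separators around an edge-dominated end -/

theorem EdgeDominates.of_finite {m : V} {r : Ray G} (h : EdgeDominates m r) {F : Set (Sym2 V)}
    (hF : F.Finite) : ∃ N, ∀ n ≥ N, (G.deleteEdges F).Reachable m (r.vert n) := by
  rw [SimpleGraph.deleteEdges_eq_inter_edgeSet]
  exact h _ Set.inter_subset_right (hF.subset Set.inter_subset_left)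

theorem JoinedOff.deleteEdges {S : Set V} {F : Set (Sym2 V)} {a b : V}
    (h : JoinedOff G (S ∪ touch F) a b) : JoinedOff (G.deleteEdges F) S a b := by
  have ha := h.left_notMem
  refine h.induct (P := fun b => JoinedOff (G.deleteEdges F) S a b)
    (JoinedOff.refl fun h' => ha (Or.inl h')) ?_
  intro x y hx hxS hyS hxy
  refine hx.trans (JoinedOff.of_adj ?_ (fun h' => hxS (Or.inl h')) (fun h' => hyS (Or.inl h')))
  rw [SimpleGraph.deleteEdges_adj]
  exact ⟨hxy, fun he => hxS (Or.inr (left_mem_touch he))⟩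

/-- The vertices joined to the tails of `r` after deleting the vertices in `σ.1` and the edges in
`σ.2`. -/
def near (r : Ray G) (σ : Set V × Set (Sym2 V)) : Set V :=
  {v | ∃ N, ∀ n ≥ N, JoinedOff (G.deleteEdges σ.2) σ.1 v (r.vert n)}

/-- A mixed separator: finitely many vertices of the edge-block of `m` and finitely many edges. -/
def IsSep (G : SimpleGraph V) (m : V) (σ : Set V × Set (Sym2 V)) : Prop :=
  σ.1.Finite ∧ σ.1 ⊆ edgeBlock G m ∧ σ.2.Finite

/-- The vertices that no mixed separator separates from `r`. -/
def core (r : Ray G) (m : V) : Set V := {v | ∀ σ, IsSep G m σ → v ∉ σ.1 → v ∈ near r σ}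

theorem isSep_edges (m : V) {F : Set (Sym2 V)} (hF : F.Finite) : IsSep G m (∅, F) :=
  ⟨Set.finite_empty, Set.empty_subset _, hF⟩

theorem mem_near_of_joinedOff {r : Ray G} {σ : Set V × Set (Sym2 V)} {u v : V}
    (h : JoinedOff (G.deleteEdges σ.2) σ.1 u v) (hv : v ∈ near r σ) : u ∈ near r σ := by
  obtain ⟨N, hN⟩ := hv
  exact ⟨N, fun n hn => h.trans (hN n hn)⟩

theorem mem_near_of_adj {r : Ray G} {σ : Set V × Set (Sym2 V)} {u v : V} (h : G.Adj u v)
    (hF : s(u, v) ∉ σ.2) (hu : u ∉ σ.1) (hv : v ∈ near r σ) : u ∈ near r σ := by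
  refine mem_near_of_joinedOff (JoinedOff.of_adj ?_ hu ?_) hv
  · rw [SimpleGraph.deleteEdges_adj]
    exact ⟨h, hF⟩
  · obtain ⟨N, hN⟩ := hv
    exact (hN N le_rfl).left_notMem

theorem ConnSet.subset_near {L : Set V} {r : Ray G} {σ : Set V × Set (Sym2 V)} (hL : ConnSet G L)
    (hσ : Disjoint L (σ.1 ∪ touch σ.2)) {v : V} (hv : v ∈ L) (hvn : v ∈ near r σ) :
    L ⊆ near r σ := by
  rw [Set.disjoint_union_right] at hσ
  intro u hu
  exact mem_near_of_joinedOff ((hL.deleteEdges hσ.2).joinedOff hσ.1 hu hv) hvn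

theorem evIn_near (r : Ray G) {m : V} {σ : Set V × Set (Sym2 V)} (hσ : IsSep G m σ) :
    r.EvIn (near r σ) := by
  obtain ⟨N, hN⟩ := Ray.tail_joined hσ.2.2 (Ray.evIn_compl_of_finite hσ.1 r)
  exact ⟨N, fun n hn => ⟨N, fun k hk => hN n hn k hk⟩⟩

theorem reachable_of_mem_near {r : Ray G} {m v : V} (hr : EdgeDominates m r)
    {F : Set (Sym2 V)} (hF : F.Finite) (h : v ∈ near r (∅, F)) :
    (G.deleteEdges F).Reachable m v := by
  obtain ⟨N, hN⟩ := hr.of_finite hF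
  obtain ⟨M, hM⟩ := h
  exact (hN (max N M) (le_max_left _ _)).trans
    (joinedOff_empty_iff.1 (hM _ (le_max_right _ _))).symm

/-- Separators consisting only of edges already suffice, because `m` stays connected to the tails of
`r`. -/
theorem core_subset {r : Ray G} {m : V} (hr : EdgeDominates m r) : core r m ⊆ edgeBlock G m :=
  fun _ hv _ hF => reachable_of_mem_near hr hF (hv _ (isSep_edges m hF) (Set.notMem_empty _))

theorem exists_not_reachable {m v : V} (h : v ∉ edgeBlock G m) :
    ∃ F : Set (Sym2 V), F.Finite ∧ ¬ (G.deleteEdges F).Reachable m v := by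
  simpa [edgeBlock] using h

/-- A vertex outside the core has only finitely many neighbours in the core. -/
theorem finite_core_neighbors {r : Ray G} {m v : V} (hv : v ∉ core r m) :
    {d | d ∈ core r m ∧ G.Adj v d}.Finite := by
  by_contra hinf
  refine hv fun σ hσ hvσ => ?_
  obtain ⟨d, ⟨hd, hvd⟩, hd'⟩ :=
    (Set.Infinite.sdiff hinf (hσ.1.union (touch_finite hσ.2.2))).nonempty
  exact mem_near_of_adj hvd (fun he => hd' (Or.inr (right_mem_touch he))) hvσ
    (hd σ hσ fun h => hd' (Or.inl h))

/-- Vertex separators can be replaced by mixed separators. -/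
theorem exists_isSep_near {r : Ray G} {m : V} (hr : EdgeDominates m r) {S : Set V}
    (hS : S.Finite) : ∃ τ, IsSep G m τ ∧
      ∀ u ∈ near r τ, ∃ N, ∀ n ≥ N, JoinedOff G S u (r.vert n) := by
  classical
  -- Vertices of `S` in the block are kept. Every other `s` is replaced by finitely many edges
  -- cutting it off from `m`, and hence from the tails of `r`.
  have hF : ∀ s, ∃ F : Set (Sym2 V), F.Finite ∧
      (s ∉ edgeBlock G m → ¬ (G.deleteEdges F).Reachable m s) := by
    intro s
    by_cases h : s ∈ edgeBlock G m
    · exact ⟨∅, Set.finite_empty, fun h' => absurd h h'⟩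
    · obtain ⟨F, hF, hF'⟩ := exists_not_reachable h
      exact ⟨F, hF, fun _ => hF'⟩
  choose F hF hF' using hF
  have hfin : (⋃ s ∈ S, F s).Finite := hS.biUnion fun s _ => hF s
  refine ⟨(S ∩ edgeBlock G m, ⋃ s ∈ S, F s),
    ⟨hS.subset Set.inter_subset_left, Set.inter_subset_right, hfin⟩, ?_⟩
  rintro u ⟨N, hN⟩
  obtain ⟨M, hM⟩ := hr.of_finite hfin
  obtain ⟨K, hK⟩ := Ray.evIn_compl_of_finite hS r
  refine ⟨max N (max M K), fun n hn => JoinedOff.symm ?_⟩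
  have hj := (hN n (by omega)).symm
  refine (hj.induct (P := fun b => JoinedOff G S (r.vert n) b ∧
    (G.deleteEdges (⋃ s ∈ S, F s)).Reachable (r.vert n) b)
    ⟨JoinedOff.refl (hK n (by omega)), SimpleGraph.Reachable.refl _⟩ ?_).1
  rintro x y ⟨hx, hx'⟩ hxS hyS hxy
  have hy' := hx'.trans hxy.reachable
  refine ⟨hx.trans (JoinedOff.of_adj (SimpleGraph.deleteEdges_le _ hxy) hx.right_notMem ?_), hy'⟩
  intro hyS'
  have hyB : y ∉ edgeBlock G m := fun h => hyS ⟨hyS', h⟩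
  refine hF' y hyB (((hM n (by omega)).trans hy').mono ?_)
  exact SimpleGraph.deleteEdges_anti (Set.subset_biUnion_of_mem (u := F) hyS')

/-! ### Peeling off the neighbourhoods of an edge-dominated end -/

/-- A mixed separator separating `q` from `r`, for `q` outside the core. -/
noncomputable def sepOf (r : Ray G) (m q : V) : Set V × Set (Sym2 V) :=
  open Classical in
  if h : ∃ σ, IsSep G m σ ∧ q ∉ σ.1 ∧ q ∉ near r σ then h.choose else (∅, ∅)

theorem isSep_sepOf (r : Ray G) (m q : V) : IsSep G m (sepOf r m q) := by
  unfold sepOf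
  split_ifs with h
  · exact h.choose_spec.1
  · exact isSep_edges m Set.finite_empty

theorem sepOf_spec {r : Ray G} {m q : V} (hq : q ∉ core r m) :
    q ∉ (sepOf r m q).1 ∧ q ∉ near r (sepOf r m q) := by
  have h : ∃ σ, IsSep G m σ ∧ q ∉ σ.1 ∧ q ∉ near r σ := by
    simpa [core] using hq
  rw [sepOf, dif_pos h]
  exact h.choose_spec.2

/-- The union of the separators `sepOf r m q` for `q ∈ Q`. -/
def supSep (r : Ray G) (m : V) (Q : Set V) : Set V × Set (Sym2 V) :=
  (⋃ q ∈ Q, (sepOf r m q).1, ⋃ q ∈ Q, (sepOf r m q).2)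

theorem isSep_supSep (r : Ray G) (m : V) {Q : Set V} (hQ : Q.Finite) :
    IsSep G m (supSep r m Q) :=
  ⟨hQ.biUnion fun q _ => (isSep_sepOf r m q).1, Set.iUnion₂_subset fun q _ => (isSep_sepOf r m q).2.1,
    hQ.biUnion fun q _ => (isSep_sepOf r m q).2.2⟩

theorem sepOf_le_supSep (r : Ray G) (m : V) {Q : Set V} {q : V} (hq : q ∈ Q) :
    (sepOf r m q).1 ⊆ (supSep r m Q).1 ∧ (sepOf r m q).2 ⊆ (supSep r m Q).2 :=
  ⟨Set.subset_biUnion_of_mem (u := fun q => (sepOf r m q).1) hq,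
    Set.subset_biUnion_of_mem (u := fun q => (sepOf r m q).2) hq⟩

/-- The vertices to be separated from `r` when the set `L` is split: those in `Q` and one vertex
of `L`. -/
noncomputable def targets (r : Ray G) (m : V) (LQ : Set V × Set V) : Set V :=
  open Classical in
  LQ.2 ∪ if h : (LQ.1 \ core r m).Nonempty then {h.some} else ∅

theorem targets_finite (r : Ray G) (m : V) {LQ : Set V × Set V} (h : LQ.2.Finite) :
    (targets r m LQ).Finite := by
  unfold targets
  split_ifs
  · exact h.union (Set.finite_singleton _)
  · exact h.union Set.finite_empty

theorem exists_target (r : Ray G) (m : V) {LQ : Set V × Set V} (h : (LQ.1 \ core r m).Nonempty) :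
    ∃ y ∈ LQ.1 \ core r m, y ∈ targets r m LQ := by
  refine ⟨h.some, h.some_mem, ?_⟩
  unfold targets
  rw [dif_pos h]
  exact Or.inr rfl

/-- The separator used for splitting `L`. -/
noncomputable def cutSep (r : Ray G) (m : V) (LQ : Set V × Set V) : Set V × Set (Sym2 V) :=
  supSep r m (targets r m LQ)

/-- The successive parts of `A` containing `v`, together with finite sets of vertices controlling
their boundaries. -/
noncomputable def stage (r : Ray G) (m : V) (A : Set V) (v : V) : ℕ → Set V × Set V
  | 0 => (A, touch (bd G A))
  | n + 1 =>
    let LQ := stage r m A v n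
    let σ := cutSep r m LQ
    (comp (G.deleteEdges σ.2) ((LQ.1 \ core r m) \ σ.1)ᶜ v, targets r m LQ ∪ (σ.1 ∪ touch σ.2))

/-- `L` cannot be separated from `r` by a mixed separator. -/
def Bad (r : Ray G) (m : V) (L : Set V) : Prop := ∀ σ, IsSep G m σ → (L ∩ near r σ).Nonempty

theorem Bad.mono {r : Ray G} {m : V} {L L' : Set V} (h : Bad r m L) (hL : L ⊆ L') : Bad r m L' :=
  fun σ hσ => (h σ hσ).mono (Set.inter_subset_inter_left _ hL)

/-! ### Stages of the peeling and its termination -/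

section Stage

variable {r : Ray G} {m : V} {A : Set V} {u v : V}

theorem stage_succ_subset (n : ℕ) : (stage r m A v (n + 1)).1 ⊆
    ((stage r m A v n).1 \ core r m) \ (cutSep r m (stage r m A v n)).1 := fun x hx => by
  have := comp_disjoint hx
  simpa using this

theorem stage_anti : Antitone fun n => (stage r m A v n).1 :=
  antitone_nat_of_succ_le fun n _ hx => (stage_succ_subset n hx).1.1

theorem stage_subset (n : ℕ) : (stage r m A v n).1 ⊆ A := stage_anti (Nat.zero_le n)

/-- The construction depends on `v` only through the component chosen at each stage, so two vertices
in a common part share its whole history. -/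
theorem stage_eq {n : ℕ} (h : u ∈ (stage r m A v n).1) : ∀ k ≤ n, stage r m A u k = stage r m A v k := by
  induction n with
  | zero =>
    intro k hk
    obtain rfl : k = 0 := by omega
    rfl
  | succ n ih =>
    have ih := ih (stage_anti (Nat.le_succ n) h)
    intro k hk
    rcases Nat.lt_or_ge n k with h1 | h1
    · obtain rfl : k = n + 1 := by omega
      have hn := ih n le_rfl
      simp only [stage] at h ⊢
      rw [hn, comp_eq h]
    · exact ih k h1

theorem connSet_stage_succ (n : ℕ) : ConnSet
    (G.deleteEdges (cutSep r m (stage r m A v n)).2) (stage r m A v (n + 1)).1 :=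
  connSet_comp _ _

theorem connSet_stage (hA : ConnSet G A) : ∀ n, ConnSet G (stage r m A v n).1
  | 0 => hA
  | _ + 1 => (connSet_stage_succ _).of_le (SimpleGraph.deleteEdges_le _)

theorem stage_finite (hA : (bd G A).Finite) : ∀ n, (stage r m A v n).2.Finite
  | 0 => touch_finite hA
  | n + 1 => by
    have h1 := targets_finite r m (stage_finite hA n)
    have h2 := isSep_supSep r m h1
    exact h1.union (h2.1.union (touch_finite h2.2.2))

theorem isSep_cutSep (hA : (bd G A).Finite) (n : ℕ) : IsSep G m (cutSep r m (stage r m A v n)) :=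
  isSep_supSep r m (targets_finite r m (stage_finite hA n))

theorem stage_snd_mono (n : ℕ) : (stage r m A v n).2 ⊆ targets r m (stage r m A v n) :=
  Set.subset_union_left

/-- How one can leave the next stage without leaving the current one. -/
theorem stage_leave {n : ℕ} {x w : V} (hx : x ∈ (stage r m A v (n + 1)).1)
    (hw : w ∉ (stage r m A v (n + 1)).1) (hwn : w ∈ (stage r m A v n).1) (hwD : w ∉ core r m)
    (hxw : G.Adj x w) : w ∈ (cutSep r m (stage r m A v n)).1 ∨
      s(x, w) ∈ (cutSep r m (stage r m A v n)).2 := by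
  by_contra! hcon
  refine hw (JoinedOff.trans hx (JoinedOff.of_adj ?_ (comp_disjoint hx) ?_))
  · rw [SimpleGraph.deleteEdges_adj]
    exact ⟨hxw, hcon.2⟩
  · exact Set.notMem_compl_iff.2 ⟨⟨hwn, hwD⟩, hcon.1⟩

/-- An edge leaving the part without entering the core either belongs to the boundary of `A` or was
cut by an earlier separator. The second component of the stage accumulates the vertices responsible.
-/
theorem stage_bd_control {n : ℕ} {x w : V} (hx : x ∈ (stage r m A v n).1)
    (hw : w ∉ (stage r m A v n).1) (hwD : w ∉ core r m) (hxw : G.Adj x w) :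
    x ∈ (stage r m A v n).2 ∨ w ∈ (stage r m A v n).2 := by
  induction n with
  | zero => exact Or.inl ⟨_, ⟨x, w, hxw, hx, hw, rfl⟩, Sym2.mem_mk_left _ _⟩
  | succ n ih =>
    by_cases hwn : w ∈ (stage r m A v n).1
    · rcases stage_leave hx hw hwn hwD hxw with h | h
      · exact Or.inr (Or.inr (Or.inl h))
      · exact Or.inl (Or.inr (Or.inr (left_mem_touch h)))
    · rcases ih (stage_anti (Nat.le_succ n) hx) hwn with h | h
      · exact Or.inl (Or.inl (stage_snd_mono n h))
      · exact Or.inr (Or.inl (stage_snd_mono n h))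

/-- All vertices deleted on the way lie in the block, being in the core or in a mixed separator.
Outside the block only boundary edges of `A` and deleted edges remain. -/
theorem stage_bd_finite (hr : EdgeDominates m r) (hA : (bd G A).Finite) (n : ℕ) :
    ∃ Φ : Set (Sym2 V), Φ.Finite ∧ ∀ x ∈ (stage r m A v n).1, ∀ w ∉ (stage r m A v n).1,
      G.Adj x w → w ∈ edgeBlock G m ∨ s(x, w) ∈ Φ := by
  induction n with
  | zero => exact ⟨_, hA, fun x hx w hw hxw => Or.inr ⟨x, w, hxw, hx, hw, rfl⟩⟩
  | succ n ih =>
    obtain ⟨Φ, hΦ, h⟩ := ih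
    refine ⟨Φ ∪ (cutSep r m (stage r m A v n)).2, hΦ.union (isSep_cutSep hA n).2.2, ?_⟩
    intro x hx w hw hxw
    by_cases hwD : w ∈ core r m
    · exact Or.inl (core_subset hr hwD)
    by_cases hwn : w ∈ (stage r m A v n).1
    · rcases stage_leave hx hw hwn hwD hxw with h' | h'
      · exact Or.inl ((isSep_cutSep hA n).2.1 h')
      · exact Or.inr (Or.inr h')
    · exact (h x (stage_anti (Nat.le_succ n) hx) w hwn hxw).imp id Or.inl

/-- Bad parts are joined to `r` off `sepOf r m q`, for every target `q`. -/
theorem stage_subset_near {n : ℕ} (hbad : Bad r m (stage r m A v (n + 1)).1) {q : V}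
    (hq : q ∈ targets r m (stage r m A v n)) :
    (stage r m A v (n + 1)).1 ⊆ near r (sepOf r m q) := by
  obtain ⟨u, hu, hun⟩ := hbad _ (isSep_sepOf r m q)
  obtain ⟨h1, h2⟩ := sepOf_le_supSep r m hq
  intro x hx
  refine mem_near_of_joinedOff (((connSet_stage_succ n) x hx u hu).mono
    (SimpleGraph.deleteEdges_anti h2) ?_) hun
  exact fun z hz hz' => (stage_succ_subset n hz').2 (h1 hz)

/-- A part that is still bad lies near `r` with respect to the separator of `q`, whereas `q` does
not. -/
theorem target_notMem {n : ℕ} (hbad : Bad r m (stage r m A v (n + 1)).1) {q : V}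
    (hq : q ∈ targets r m (stage r m A v n)) : q ∉ (stage r m A v (n + 1)).1 := fun hqL =>
  (sepOf_spec (stage_succ_subset n hqL).1.2).2 (stage_subset_near hbad hq hqL)

theorem snd_notMem {n : ℕ} (hbad : Bad r m (stage r m A v (n + 1)).1) {q : V}
    (hq : q ∈ (stage r m A v n).2) : q ∉ (stage r m A v (n + 1)).1 :=
  target_notMem hbad (stage_snd_mono n hq)

/-- The peeling process terminates at every vertex. -/
theorem exists_not_bad (v : V) : ∃ n, ¬ Bad r m (stage r m A v n).1 := by
  by_contra! hbad
  have hne : ∀ n, (stage r m A v n).1.Nonempty := fun n =>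
    (hbad n _ (isSep_edges m Set.finite_empty)).mono Set.inter_subset_left
  have hv : ∀ n, v ∈ (stage r m A v (n + 1)).1 := by
    intro n
    obtain ⟨x, hx⟩ := hne (n + 1)
    exact JoinedOff.refl (JoinedOff.left_notMem hx)
  -- A vertex that survives forever keeps its neighbours in `A` outside the core. If the edge to `w`
  -- had been cut, `x` would have become a target; if `w` was a deleted vertex, it becomes a target,
  -- so `x` is near `r` off its separator, which must therefore contain the edge, and again `x`
  -- becomes a target.
  have hclosed : ∀ x w, (∀ n, x ∈ (stage r m A v n).1) → w ∈ A → w ∉ core r m → G.Adj x w →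
      ∀ n, w ∈ (stage r m A v n).1 := by
    intro x w hx hwA hwD hxw n
    induction n with
    | zero => exact hwA
    | succ n ih =>
      by_contra hw
      rcases stage_leave (hx (n + 1)) hw ih hwD hxw with h | h
      · have hq : w ∈ targets r m (stage r m A v (n + 1)) :=
          stage_snd_mono _ (Or.inr (Or.inl h))
        by_cases he : s(x, w) ∈ (sepOf r m w).2
        · refine snd_notMem (hbad (n + 3)) ?_ (hx (n + 3))
          exact Or.inr (Or.inr (left_mem_touch ((sepOf_le_supSep r m hq).2 he)))
        · refine (sepOf_spec hwD).2 (mem_near_of_adj hxw.symm ?_ (sepOf_spec hwD).1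
            (stage_subset_near (hbad (n + 2)) hq (hx (n + 2))))
          rwa [Sym2.eq_swap]
      · exact snd_notMem (hbad (n + 2)) (Or.inr (Or.inr (left_mem_touch h))) (hx (n + 2))
  have hsub : ∀ y ∈ (stage r m A v 1).1, ∀ n, y ∈ (stage r m A v n).1 := by
    intro y hy
    refine JoinedOff.induct (P := fun y => ∀ n, y ∈ (stage r m A v n).1) hy
      (fun n => stage_anti (Nat.le_succ n) (hv n)) ?_
    intro x w hx _ hw hxw
    have hw' := not_not.1 hw
    exact hclosed x w hx hw'.1.1 hw'.1.2 (SimpleGraph.deleteEdges_le _ hxw)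
  -- Now the whole first part survives, but each splitting removes one chosen vertex of its part.
  obtain ⟨y, hy, hyt⟩ := exists_target r m (LQ := stage r m A v 1)
    ⟨v, hv 0, (stage_succ_subset 0 (hv 0)).1.2⟩
  exact target_notMem (hbad 2) hyt (hsub y hy.1 2)

end Stage

/-! ### Splitting a connected set at a vertex -/

/-- A decomposition of `A` at the vertex `m`: disjoint connected pieces `pc v` with finite edge
boundary, arranged into groups `gr v`, such that the groups converge to the end edge-dominated
by `m`. -/
structure Decomp (G : SimpleGraph V) (A : Set V) (m : V) where
  cov : Set V
  pc : V → Set V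
  gr : V → Set V
  cov_subset : cov ⊆ A
  notMem : m ∉ cov
  mem_pc : ∀ v ∈ cov, v ∈ pc v
  pc_subset : ∀ v ∈ cov, pc v ⊆ gr v
  gr_subset : ∀ v ∈ cov, gr v ⊆ cov
  conn : ∀ v ∈ cov, ConnSet G (pc v)
  bd_finite : ∀ v ∈ cov, (bd G (pc v)).Finite
  pc_eq : ∀ v ∈ cov, ∀ u ∈ pc v, pc u = pc v
  gr_eq : ∀ v ∈ cov, ∀ u ∈ gr v, gr u = gr v
  dichotomy : ∀ s : Ray G, s.EvIn A → EdgeDominates m s ∨ ∃ v ∈ cov, s.EvIn (pc v)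
  close : ∀ r : Ray G, EdgeDominates m r → ∀ S : Set V, S.Finite → ∃ 𝒯 : Set (Set V), 𝒯.Finite ∧
    ∀ v ∈ cov, gr v ∉ 𝒯 → ∀ s : Ray G, s.EvIn (pc v) → ¬ Separates S r s
  apart : ∀ r : Ray G, EdgeDominates m r → ∀ v ∈ cov, ∃ S : Set V, S.Finite ∧
    ∀ s : Ray G, s.EvIn (gr v) → Separates S r s

theorem not_separates_of_evIn {S : Set V} (hS : S.Finite) {r s : Ray G}
    (h : s.EvIn {u | ∃ N, ∀ n ≥ N, JoinedOff G S u (r.vert n)}) : ¬ Separates S r s := by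
  obtain ⟨N, hN⟩ := h
  obtain ⟨M, hM⟩ := Ray.tail_joined Set.finite_empty (Ray.evIn_compl_of_finite hS s)
  obtain ⟨K, hK⟩ := hN (max N M) (le_max_left _ _)
  exact not_not.2 ⟨max K M, fun i hi j hj => (hK i (le_trans (le_max_left _ _) hi)).symm.trans
    ((hM _ (le_max_right _ _) j (le_trans (le_max_right _ _) hj)).mono
      (SimpleGraph.deleteEdges_le _) subset_rfl)⟩

/-- A ray meeting the edge-block of `m` again and again is edge-dominated by `m`. -/
theorem evIn_compl_edgeBlock {m : V} {s : Ray G} (hs : ¬ EdgeDominates m s) :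
    s.EvIn (edgeBlock G m)ᶜ := by
  have : ∃ F : Set (Sym2 V), F ⊆ G.edgeSet ∧ F.Finite ∧
      ¬ ∃ N, ∀ n ≥ N, (G.deleteEdges F).Reachable m (s.vert n) := by
    simpa only [EdgeDominates, not_forall, exists_prop] using hs
  obtain ⟨F, -, hF, hn⟩ := this
  obtain ⟨N, hN⟩ := Ray.tail_joined (S := ∅) hF (by simpa using ⟨0, fun n _ => Set.mem_univ _⟩)
  refine ⟨N, fun n hn' hB => hn ⟨N, fun k hk => ?_⟩⟩
  exact (hB F hF).trans (hN n hn' k hk).to_reachable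

theorem EdgeDominates.evIn {m : V} {r : Ray G} (hr : EdgeDominates m r) {A : Set V}
    (hA : (bd G A).Finite) (hm : m ∈ A) : r.EvIn A := by
  obtain ⟨N, hN⟩ := hr.of_finite hA
  exact ⟨N, fun n hn => reachable_mem_of_bd_subset subset_rfl (hN n hn) hm⟩

theorem evIn_comp {L : Set V} {s : Ray G} (hs : s.EvIn L) :
    ∃ N, s.vert N ∈ L ∧ s.EvIn (comp G Lᶜ (s.vert N)) := by
  obtain ⟨M, hM⟩ := hs
  obtain ⟨N, hN⟩ := Ray.tail_joined (r := s) (S := Lᶜ) Set.finite_empty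
    ⟨M, fun n hn => by simpa using hM n hn⟩
  exact ⟨max N M, hM _ (le_max_right _ _), max N M, fun n hn =>
    (hN _ (le_max_left _ _) n (le_trans (le_max_left _ _) hn)).mono
      (SimpleGraph.deleteEdges_le _) subset_rfl⟩

/-- The decomposition at a vertex that edge-dominates no ray. -/
theorem exists_decomp_of_not_edgeDominates {A : Set V} (hA : (bd G A).Finite) {m : V}
    (hm : ∀ r : Ray G, ¬ EdgeDominates m r) : Nonempty (Decomp G A m) := by
  refine ⟨⟨A \ edgeBlock G m, fun v => comp G (A \ edgeBlock G m)ᶜ v, fun _ => A \ edgeBlock G m,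
    Set.sdiff_subset, fun h => h.2 (self_mem_edgeBlock m), fun v hv => JoinedOff.refl (by simpa using hv),
    fun v _ u hu => ?_, fun _ _ => subset_rfl, fun v _ => connSet_comp _ _, fun v hv => ?_,
    fun v _ u hu => comp_eq hu, fun _ _ _ _ => rfl, fun s hs => Or.inr ?_,
    fun r hr => absurd hr (hm r), fun r hr => absurd hr (hm r)⟩⟩
  · exact Set.notMem_compl_iff.1 (comp_disjoint hu)
  · have hsub : comp G (A \ edgeBlock G m)ᶜ v ⊆ A \ edgeBlock G m :=
      fun u hu => Set.notMem_compl_iff.1 (comp_disjoint hu)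
    have hfin : {e | ∃ x ∈ comp G (A \ edgeBlock G m)ᶜ v, ∃ y ∈ edgeBlock G m,
        G.Adj x y ∧ e = s(x, y)}.Finite := by
      -- By the star-comb lemma, infinitely many edges to the block would produce a ray
      -- edge-dominated by `m`.
      by_contra hinf
      obtain ⟨r, -, hr⟩ := exists_ray_edgeDominates (connSet_comp _ _)
        (Set.disjoint_left.2 fun u hu => (hsub hu).2) hinf
      exact hm r hr
    refine (hfin.union hA).subset ?_
    rintro _ ⟨x, y, hxy, hx, hy, rfl⟩
    by_cases hyB : y ∈ edgeBlock G m
    · exact Or.inl ⟨x, hx, y, hyB, hxy, rfl⟩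
    · refine Or.inr ⟨x, y, hxy, (hsub hx).1, fun hyA => hy ?_, rfl⟩
      exact JoinedOff.trans hx (JoinedOff.of_adj hxy (comp_disjoint hx)
        (Set.notMem_compl_iff.2 ⟨hyA, hyB⟩))
  · obtain ⟨N, hN, hev⟩ := evIn_comp (hs.inter (evIn_compl_edgeBlock (hm s)))
    exact ⟨_, hN, hev⟩

/-! ### Good parts, their pieces and groups -/

section Level

variable {r : Ray G} {m : V} {A : Set V} {u v : V}

/-- The last level at which the part containing `v` is bad. -/
noncomputable def level (r : Ray G) (m : V) (A : Set V) (v : V) : ℕ :=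
  sInf {n | ¬ Bad r m (stage r m A v (n + 1)).1}

/-- The first part containing `v` that is not bad. -/
noncomputable def goodPart (r : Ray G) (m : V) (A : Set V) (v : V) : Set V :=
  (stage r m A v (level r m A v + 1)).1

theorem not_bad_goodPart (v : V) : ¬ Bad r m (goodPart r m A v) := by
  have hne : {n | ¬ Bad r m (stage r m A v (n + 1)).1}.Nonempty := by
    obtain ⟨n, hn⟩ := exists_not_bad (r := r) (m := m) (A := A) v
    exact ⟨n, fun h => hn (h.mono (stage_anti (Nat.le_succ n)))⟩
  exact Nat.sInf_mem hne

theorem bad_of_le_level (hA : Bad r m A) {n : ℕ} (hn : n ≤ level r m A v) :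
    Bad r m (stage r m A v n).1 := by
  cases n with
  | zero => exact hA
  | succ n =>
    by_contra h
    have : level r m A v ≤ n := Nat.sInf_le h
    omega

theorem le_level_of_bad {n : ℕ} (hn : Bad r m (stage r m A v n).1) : n ≤ level r m A v := by
  by_contra h
  exact not_bad_goodPart v (hn.mono (stage_anti (by omega)))

theorem level_eq (h : u ∈ goodPart r m A v) : level r m A u = level r m A v := by
  have he := stage_eq h
  refine le_antisymm ?_ ?_
  · refine Nat.sInf_le ?_
    show ¬ Bad r m (stage r m A u (level r m A v + 1)).1
    rw [he _ le_rfl]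
    exact not_bad_goodPart v
  · by_contra! hlt
    refine not_bad_goodPart (r := r) (m := m) (A := A) u ?_
    unfold goodPart
    rw [he _ (by omega)]
    exact not_not.1 (Nat.notMem_of_lt_sInf (m := level r m A u) hlt)

theorem goodPart_eq (h : u ∈ goodPart r m A v) : goodPart r m A u = goodPart r m A v := by
  unfold goodPart
  rw [level_eq h, stage_eq h _ le_rfl]

/-- Only vertices of the block are ever deleted, so the peeling keeps every other vertex of `A`. -/
theorem mem_stage (hA : (bd G A).Finite) (hr : EdgeDominates m r) (hv : v ∈ A \ edgeBlock G m) :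
    ∀ n, v ∈ (stage r m A v n).1 := by
  intro n
  induction n with
  | zero => exact hv.1
  | succ n ih =>
    exact JoinedOff.refl (Set.notMem_compl_iff.2 ⟨⟨ih, fun h => hv.2 (core_subset hr h)⟩,
      fun h => hv.2 ((isSep_cutSep hA n).2.1 h)⟩)

/-- The core vertices adjacent to the good part containing `v`. -/
def attach (r : Ray G) (m : V) (A : Set V) (v : V) : Set V :=
  {d | d ∈ core r m ∧ ∃ l ∈ goodPart r m A v, G.Adj l d}

theorem goodPart_subset (v : V) : goodPart r m A v ⊆ A \ core r m := fun _ hx =>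
  ⟨stage_subset _ hx, (stage_succ_subset _ hx).1.2⟩

/-- Take a mixed separator cutting the good part off from `r`. Core vertices outside it are near
`r`, so every edge to the core meets its vertices or belongs to its edges; its vertices in the good
part have finitely many core neighbours each. -/
theorem attach_finite (v : V) : (attach r m A v).Finite := by
  have := not_bad_goodPart (r := r) (m := m) (A := A) v
  simp only [Bad, not_forall] at this
  obtain ⟨σ, hσ, hne⟩ := this
  rw [Set.not_nonempty_iff_eq_empty] at hne
  refine ((hσ.1.union (touch_finite hσ.2.2)).union ((hσ.1.inter_of_left (goodPart r m A v)).biUnion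
    (t := fun l => {d | d ∈ core r m ∧ G.Adj l d}) fun l hl =>
      finite_core_neighbors (goodPart_subset v hl.2).2)).subset ?_
  rintro d ⟨hd, l, hl, hld⟩
  by_cases hdσ : d ∈ σ.1
  · exact Or.inl (Or.inl hdσ)
  by_cases hlσ : l ∈ σ.1
  · exact Or.inr (Set.mem_biUnion (show l ∈ σ.1 ∩ goodPart r m A v from ⟨hlσ, hl⟩) ⟨hd, hld⟩)
  by_cases he : s(l, d) ∈ σ.2
  · exact Or.inl (Or.inr (right_mem_touch he))
  exact absurd hne (Set.nonempty_iff_ne_empty.1 ⟨l, hl, mem_near_of_adj hld he hlσ (hd σ hσ hdσ)⟩)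

/-- The index of the group containing `v`. -/
noncomputable def groupIndex (r : Ray G) (m : V) (A : Set V) (v : V) : ℕ × (Set V × Set V) × Set V :=
  (level r m A v, stage r m A v (level r m A v), attach r m A v)

theorem groupIndex_eq (h : u ∈ goodPart r m A v) : groupIndex r m A u = groupIndex r m A v := by
  unfold groupIndex attach
  rw [level_eq h, stage_eq h _ (Nat.le_succ _), goodPart_eq h]

/-- The piece containing `v`. -/
noncomputable def piece (r : Ray G) (m : V) (A : Set V) (v : V) : Set V :=
  comp G (goodPart r m A v \ edgeBlock G m)ᶜ v

theorem piece_subset (v : V) : piece r m A v ⊆ goodPart r m A v \ edgeBlock G m :=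
  fun _ hu => Set.notMem_compl_iff.1 (comp_disjoint hu)

theorem bad_of_evIn {L : Set V} (h : r.EvIn L) : Bad r m L :=
  fun _ hσ => (h.inter (evIn_near r hσ)).nonempty

theorem bad_of_evIn_of_toEnd_eq {L : Set V} {s : Ray G} (h : s.EvIn L) (hsr : s.toEnd = r.toEnd) :
    Bad r m L := by
  intro σ hσ
  obtain ⟨N, hN⟩ := not_not.1 (toEnd_eq_iff.1 hsr _ (hσ.1.union (touch_finite hσ.2.2)))
  obtain ⟨M, hM⟩ := h
  exact ⟨_, hM (max N M) (le_max_right _ _), N, fun n hn =>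
    (hN _ (le_max_left _ _) n hn).deleteEdges⟩

/-- Uniqueness of the edge-dominated end enters here: infinitely many edges to the block would give
a ray in the good part equivalent to `r`, making that part bad. -/
theorem piece_bd_finite (hA : (bd G A).Finite) (hr : EdgeDominates m r)
    (huniq : ∀ s : Ray G, EdgeDominates m s → s.toEnd = r.toEnd) (v : V) :
    (bd G (piece r m A v)).Finite := by
  have hsub := piece_subset (r := r) (m := m) (A := A) v
  have hfin : {e | ∃ x ∈ piece r m A v, ∃ y ∈ edgeBlock G m, G.Adj x y ∧ e = s(x, y)}.Finite := by
    by_contra hinf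
    obtain ⟨s, hs, hsd⟩ := exists_ray_edgeDominates (connSet_comp _ _)
      (Set.disjoint_left.2 fun u hu => (hsub hu).2) hinf
    exact not_bad_goodPart v (bad_of_evIn_of_toEnd_eq (r := r)
      ⟨0, fun n _ => (hsub (hs n)).1⟩ (huniq s hsd))
  obtain ⟨Φ, hΦ, h⟩ := stage_bd_finite (v := v) hr hA (level r m A v + 1)
  refine (hfin.union hΦ).subset ?_
  rintro _ ⟨x, y, hxy, hx, hy, rfl⟩
  by_cases hyB : y ∈ edgeBlock G m
  · exact Or.inl ⟨x, hx, y, hyB, hxy, rfl⟩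
  · refine Or.inr ((h x (hsub hx).1 y (fun hyL => hy ?_) hxy).resolve_left hyB)
    exact JoinedOff.trans hx (JoinedOff.of_adj hxy (comp_disjoint hx)
      (Set.notMem_compl_iff.2 ⟨hyL, hyB⟩))

/-- A ray not edge-dominated by `m` has a tail in a piece. -/
theorem evIn_piece (hc : ConnSet G A) (hA : (bd G A).Finite) (hbA : Bad r m A)
    (hr : EdgeDominates m r)
    {s : Ray G} (hs : s.EvIn A) (hsd : ¬ EdgeDominates m s) :
    ∃ v ∈ A \ edgeBlock G m, s.EvIn (piece r m A v) := by
  have hsB := evIn_compl_edgeBlock hsd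
  -- The tail of `s` avoids the block, so no cut deletes its vertices, and finitely many deleted
  -- edges leave a tail in one component.
  have hstage : ∀ n, ∃ k, ∀ j ≥ k, s.vert j ∈ (stage r m A (s.vert k) n).1 := by
    intro n
    induction n with
    | zero => exact hs
    | succ n ih =>
      obtain ⟨k, hk⟩ := ih
      have hσ := isSep_cutSep (v := s.vert k) hA n (r := r) (m := m)
      have hev : s.EvIn (((stage r m A (s.vert k) n).1 \ core r m) \
          (cutSep r m (stage r m A (s.vert k) n)).1)ᶜᶜ := by
        rw [compl_compl]
        refine Ray.EvIn.mono (Ray.EvIn.inter (A := (stage r m A (s.vert k) n).1) ⟨k, hk⟩ hsB) fun x hx => ?_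
        exact ⟨⟨hx.1, fun h => hx.2 (core_subset hr h)⟩, fun h => hx.2 (hσ.2.1 h)⟩
      obtain ⟨N, hN⟩ := Ray.tail_joined hσ.2.2 hev
      refine ⟨max N k, fun j hj => ?_⟩
      have he := stage_eq (hk (max N k) (le_max_right _ _)) n le_rfl
      have := hN (max N k) (le_max_left _ _) j (le_trans (le_max_left _ _) hj)
      show s.vert j ∈ comp _ _ _
      rw [he]
      exact this
  suffices hgood : ∃ v, s.EvIn (goodPart r m A v) by
    obtain ⟨v, hv⟩ := hgood
    obtain ⟨N, hN, hev⟩ := evIn_comp (hv.inter hsB)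
    refine ⟨s.vert N, ⟨(goodPart_subset v hN.1).1, hN.2⟩, ?_⟩
    unfold piece
    rw [goodPart_eq hN.1]
    exact hev
  by_contra! hno
  have hbad : ∀ n k, (∀ j ≥ k, s.vert j ∈ (stage r m A (s.vert k) n).1) →
      Bad r m (stage r m A (s.vert k) n).1 := by
    intro n k hk
    by_contra hb
    refine hno (s.vert k) ⟨k, fun j hj => ?_⟩
    have : level r m A (s.vert k) + 1 ≤ n := by
      by_contra hlt
      exact hb (bad_of_le_level hbA (by omega))
    exact stage_anti this (hk j hj)
  have : ∃ F : Set (Sym2 V), F ⊆ G.edgeSet ∧ F.Finite ∧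
      ¬ ∃ N, ∀ n ≥ N, (G.deleteEdges F).Reachable m (s.vert n) := by
    simpa only [EdgeDominates, not_forall, exists_prop] using hsd
  obtain ⟨F, -, hF, hF'⟩ := this
  -- Each vertex touched by `F` has left the bad parts by stage `K`. So the bad part at stage `K`
  -- around the tail of `s` is intact in `G ∖ F`; as it meets the vertices near `r`, `m` reaches
  -- `s`, a contradiction.
  choose ν hν using exists_not_bad (r := r) (m := m) (A := A)
  obtain ⟨K, hK⟩ := ((touch_finite hF).image ν).bddAbove
  obtain ⟨k, hk⟩ := hstage K
  have hb := hbad K k hk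
  have hdis : Disjoint (stage r m A (s.vert k) K).1 (touch F) := by
    rw [Set.disjoint_left]
    intro u hu huF
    refine hν u (Bad.mono ?_ (stage_anti (hK (Set.mem_image_of_mem ν huF))))
    show Bad r m (stage r m A u K).1
    rw [stage_eq hu K le_rfl]
    exact hb
  obtain ⟨u, hu, hun⟩ := hb _ (isSep_edges m hF)
  have hsub := (connSet_stage hc K).subset_near (σ := (∅, F)) (by simpa using hdis) hu hun
  exact hF' ⟨k, fun j hj => reachable_of_mem_near hr hF (hsub (hk j hj))⟩

/-- The groups converge to `r`. -/
theorem exists_finite_groups (hc : ConnSet G A) (hbA : Bad r m A)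
    {τ : Set V × Set (Sym2 V)} (hτ : IsSep G m τ) :
    ∃ 𝒥 : Set (ℕ × (Set V × Set V) × Set V), 𝒥.Finite ∧
      ∀ v, groupIndex r m A v ∉ 𝒥 → goodPart r m A v ⊆ near r τ := by
  have hfin : (τ.1 ∪ touch τ.2).Finite := hτ.1.union (touch_finite hτ.2.2)
  -- The exceptional indices: those of good parts touched by `τ`, and those whose bad parent is
  -- touched while all core neighbours lie in `τ.1`. Otherwise the good part is connected to `r`
  -- through its untouched parent or through a core vertex outside `τ.1`.
  refine ⟨(groupIndex r m A '' (τ.1 ∪ touch τ.2)) ∪ ⋃ u ∈ τ.1 ∪ touch τ.2,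
    (fun p : ℕ × Set V => (p.1, stage r m A u p.1, p.2)) '' (Set.Iic (level r m A u) ×ˢ 𝒫 τ.1),
    (hfin.image _).union (hfin.biUnion fun u _ =>
      ((Set.finite_Iic _).prod hτ.1.finite_subsets).image _), fun v hv => ?_⟩
  have hbL := bad_of_le_level (v := v) hbA le_rfl
  have hconn : ConnSet G (goodPart r m A v) := connSet_stage hc _
  by_cases h1 : Disjoint (goodPart r m A v) (τ.1 ∪ touch τ.2)
  · by_cases h2 : Disjoint (stage r m A v (level r m A v)).1 (τ.1 ∪ touch τ.2)
    · obtain ⟨u, hu, hun⟩ := hbL τ hτ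
      exact (stage_anti (Nat.le_succ _)).trans ((connSet_stage hc _).subset_near h2 hu hun)
    · obtain ⟨u, hu, huτ⟩ := Set.not_disjoint_iff.1 h2
      have he := stage_eq hu _ le_rfl
      by_cases h3 : attach r m A v ⊆ τ.1
      · have hidx : groupIndex r m A v ∈ (fun p : ℕ × Set V => (p.1, stage r m A u p.1, p.2)) ''
            (Set.Iic (level r m A u) ×ˢ 𝒫 τ.1) := by
          refine ⟨(level r m A v, attach r m A v), ⟨le_level_of_bad ?_, h3⟩, ?_⟩
          · rw [he]
            exact hbL
          · simp only [groupIndex, he]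
        exact absurd (Or.inr (Set.mem_biUnion huτ hidx)) hv
      · obtain ⟨d, ⟨hd, l, hl, hld⟩, hdτ⟩ := Set.not_subset.1 h3
        have hlτ := Set.disjoint_left.1 h1 hl
        exact hconn.subset_near h1 hl (mem_near_of_adj hld
          (fun he => hlτ (Or.inr (left_mem_touch he))) (fun h => hlτ (Or.inl h)) (hd τ hτ hdτ))
  · obtain ⟨u, hu, huτ⟩ := Set.not_disjoint_iff.1 h1
    exact absurd (Or.inl ⟨u, huτ, groupIndex_eq hu⟩) hv

/-- Each group is separated from `r` by finitely many vertices. -/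
theorem exists_finite_separates (hA : (bd G A).Finite) (v : V) : ∃ S : Set V, S.Finite ∧
    ∀ s : Ray G, s.EvIn {u | u ∈ goodPart r m A u ∧ groupIndex r m A u = groupIndex r m A v} →
      Separates S r s := by
  have hfin := (attach_finite (r := r) (m := m) (A := A) v).union
    (stage_finite (r := r) (m := m) (v := v) hA (level r m A v + 1))
  -- The index determines this separator, so it serves the whole group. It blocks every exit from
  -- each good part, into the core or elsewhere; a ray not separated from `r` would force `r` into a
  -- good part.
  refine ⟨_, hfin, fun s hs hns => ?_⟩
  obtain ⟨N, hN⟩ := hns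
  obtain ⟨M, hM⟩ := hs
  obtain ⟨hu, hidx⟩ := hM (max N M) (le_max_right _ _)
  have hj := fun n (hn : n ≥ N) => (hN n hn (max N M) (le_max_left _ _)).symm
  generalize s.vert (max N M) = u at hu hidx hj
  simp only [groupIndex, Prod.mk.injEq] at hidx
  obtain ⟨hl, hst, hat⟩ := hidx
  have hQ : (stage r m A u (level r m A u + 1)).2 = (stage r m A v (level r m A v + 1)).2 := by
    simp only [stage, hst]
  refine not_bad_goodPart (r := r) (m := m) (A := A) u (bad_of_evIn ⟨N, fun n hn => ?_⟩)
  refine (hj n hn).induct (P := fun w => w ∈ goodPart r m A u) hu ?_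
  intro x w hx hxS hwS hxw
  by_contra hw
  by_cases hwD : w ∈ core r m
  · refine hwS (Or.inl ?_)
    rw [← hat]
    exact ⟨hwD, x, hx, hxw⟩
  · rcases stage_bd_control hx hw hwD hxw with h | h
    · exact hxS (Or.inr (hQ ▸ h))
    · exact hwS (Or.inr (hQ ▸ h))

/-- The decomposition at a vertex that edge-dominates the ray `r`. -/
theorem exists_decomp_of_edgeDominates (hc : ConnSet G A) (hA : (bd G A).Finite) (hm : m ∈ A)
    (hr : EdgeDominates m r) (huniq : ∀ s : Ray G, EdgeDominates m s → s.toEnd = r.toEnd) :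
    Nonempty (Decomp G A m) := by
  have hbA : Bad r m A := bad_of_evIn (hr.evIn hA hm)
  have hmem : ∀ v ∈ A \ edgeBlock G m, v ∈ goodPart r m A v := fun v hv => mem_stage hA hr hv _
  let gr : ℕ × (Set V × Set V) × Set V → Set V := fun i =>
    {u | u ∈ A \ edgeBlock G m ∧ groupIndex r m A u = i}
  have hsame : ∀ s : Ray G, EdgeDominates m s → ∀ S : Set V, S.Finite → ¬ Separates S s r :=
    fun s hs S hS => toEnd_eq_iff.1 (huniq s hs) S hS
  have hpg : ∀ v, ∀ u ∈ piece r m A v, u ∈ A \ edgeBlock G m ∧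
      groupIndex r m A u = groupIndex r m A v := fun v u hu =>
    ⟨⟨(goodPart_subset v (piece_subset v hu).1).1, (piece_subset v hu).2⟩,
      groupIndex_eq (piece_subset v hu).1⟩
  refine ⟨⟨A \ edgeBlock G m, piece r m A, fun v => gr (groupIndex r m A v), Set.sdiff_subset,
    fun h => h.2 (self_mem_edgeBlock m),
    fun v hv => JoinedOff.refl (Set.notMem_compl_iff.2 ⟨hmem v hv, hv.2⟩), fun v _ u hu => hpg v u hu,
    fun v _ u hu => hu.1, fun v _ => connSet_comp _ _, fun v _ => piece_bd_finite hA hr huniq v,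
    fun v _ u hu => ?_, fun v _ u hu => ?_, fun s hs => ?_, fun r' hr' S hS => ?_,
    fun r' hr' v _ => ?_⟩⟩
  · unfold piece
    rw [goodPart_eq (piece_subset v hu).1]
    exact comp_eq hu
  · show gr _ = gr _
    rw [hu.2]
  · by_cases hsd : EdgeDominates m s
    · exact Or.inl hsd
    · exact Or.inr (evIn_piece hc hA hbA hr hs hsd)
  · obtain ⟨τ, hτ, hnear⟩ := exists_isSep_near hr hS
    obtain ⟨𝒥, h𝒥, hJ⟩ := exists_finite_groups hc hbA hτ
    refine ⟨gr '' 𝒥, h𝒥.image _, fun v hv hgr s hs => ?_⟩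
    have hsub := hJ v fun h => hgr ⟨_, h, rfl⟩
    refine not_separates_trans (hsame r' hr' S hS) (not_separates_of_evIn hS (hs.mono fun u hu => ?_))
    exact hnear u (hsub (piece_subset v hu).1)
  · obtain ⟨S, hS, hsep⟩ := exists_finite_separates hA v (r := r) (m := m)
    refine ⟨S, hS, fun s hs => ?_⟩
    by_contra hns
    exact not_separates_trans (not_separates_symm (hsame r' hr' S hS)) hns
      (hsep s (hs.mono fun u hu => ⟨hmem u hu.1, hu.2⟩))

end Level

theorem exists_decomp (hG : ∀ (v : V) (ω η : Ends G), EdgeDominatesEnd v ω → EdgeDominatesEnd v η →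
    ω = η) {A : Set V} (hc : ConnSet G A) (hA : (bd G A).Finite) {m : V} (hm : m ∈ A) :
    Nonempty (Decomp G A m) := by
  by_cases h : ∃ r : Ray G, EdgeDominates m r
  · obtain ⟨r, hr⟩ := h
    exact exists_decomp_of_edgeDominates hc hA hm hr fun s hs =>
      hG m _ _ ((edgeDominatesEnd_toEnd m s).2 hs) ((edgeDominatesEnd_toEnd m r).2 hr)
  · exact exists_decomp_of_not_edgeDominates hA (not_exists.1 h)

/-! ### The tree of successive decompositions -/

/-- The nonempty connected sets with finite edge boundary. -/
abbrev Part (G : SimpleGraph V) : Type u := {A : Set V // A.Nonempty ∧ ConnSet G A ∧ (bd G A).Finite}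

/-- A chosen decomposition of every part at each of its vertices. -/
abbrev DecompChoice (G : SimpleGraph V) : Type u := ∀ (A : Part G) (m : A.1), Decomp G A.1 m

/-- The vertex at which a part is decomposed: the head of the queue, if possible. -/
noncomputable def pick (N : Part G × List V) : N.1.1 :=
  open Classical in
  if h : ∃ x ∈ N.1.1, N.2.head? = some x then ⟨h.choose, h.choose_spec.1⟩
  else ⟨N.1.2.1.some, N.1.2.1.some_mem⟩

theorem pick_eq {N : Part G × List V} {x : V} {l : List V} (hx : x ∈ N.1.1) (hl : N.2 = x :: l) :
    (pick N).1 = x := by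
  have h : ∃ x ∈ N.1.1, N.2.head? = some x := ⟨x, hx, by simp [hl]⟩
  have h2 := h.choose_spec.2
  rw [pick, dif_pos h]
  simp only [hl, List.head?_cons, Option.some.injEq] at h2 ⊢
  exact h2.symm

/-- The states of the decomposition: a part with a queue, and possibly a group of pieces of it. -/
abbrev State (G : SimpleGraph V) : Type u := (Part G × List V) × Option (Set V)

/-- The set of vertices represented by a state. -/
def State.carrier (σ : State G) : Set V := σ.2.getD σ.1.1.1

/-- The inner end vertices of the boundary edges of a part. -/
noncomputable def innerList (A : Part G) : List V := (touch_finite A.2.2.2).toFinset.toList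

theorem mem_innerList {A : Part G} {x y : V} (hx : x ∈ A.1) (hy : y ∉ A.1) (hxy : G.Adj x y) :
    x ∈ innerList A := by
  simp only [innerList, Finset.mem_toList, Set.Finite.mem_toFinset]
  exact ⟨_, ⟨x, y, hxy, hx, hy, rfl⟩, Sym2.mem_mk_left _ _⟩

variable (D : DecompChoice G)

/-- The decomposition of the part of a state. -/
noncomputable def dec (N : Part G × List V) : Decomp G N.1.1 (pick N).1 := D N.1 (pick N)

/-- The children of a state; the children of `none` are the components of `G`. -/
def Child : Option (State G) → State G → Prop
  | none, τ => τ.2 = none ∧ τ.1.2 = [] ∧ ∃ v, τ.1.1.1 = comp G ∅ v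
  | some (N, none), τ => τ.1 = N ∧ ∃ v ∈ (dec D N).cov, τ.2 = some ((dec D N).gr v)
  | some (N, some P), τ => τ.2 = none ∧ τ.1.2 = N.2.tail ++ innerList τ.1.1 ∧
      ∃ v ∈ (dec D N).cov, v ∈ P ∧ τ.1.1.1 = (dec D N).pc v

/-- Sequences of states, the last one first, each a child of the previous one. -/
def Valid : List (State G) → Prop
  | [] => True
  | σ :: s => Valid s ∧ Child D s.head? σ

/-- The properties common to all states in valid sequences. -/
def WF (σ : State G) : Prop :=
  (σ.2 = none → ∀ x ∈ σ.1.1.1, ∀ y ∉ σ.1.1.1, G.Adj x y → x ∈ σ.1.2) ∧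
    ∀ P, σ.2 = some P → ∃ v ∈ (dec D σ.1).cov, P = (dec D σ.1).gr v

variable {D}

theorem Child.wf : ∀ {p : Option (State G)} {τ : State G}, Child D p τ → WF D τ
  | none, τ, h => by
    obtain ⟨h1, h2, v, hv⟩ := h
    refine ⟨fun _ x hx y hy hxy => absurd ?_ hy, fun P hP => by simp [h1] at hP⟩
    rw [hv] at hx ⊢
    exact JoinedOff.trans hx (JoinedOff.of_adj hxy (Set.notMem_empty _) (Set.notMem_empty _))
  | some (N, none), τ, h => by
    obtain ⟨rfl, v, hv, h2⟩ := h
    refine ⟨fun h => by simp [h] at h2, fun P hP => ⟨v, hv, ?_⟩⟩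
    rw [h2] at hP
    exact (Option.some.inj hP).symm
  | some (N, some P), τ, h => by
    obtain ⟨h1, h2, v, hv, -, h3⟩ := h
    refine ⟨fun _ x hx y hy hxy => ?_, fun P hP => by simp [h1] at hP⟩
    rw [h2]
    exact List.mem_append_right _ (mem_innerList hx hy hxy)

theorem Valid.wf {σ : State G} {s : List (State G)} (h : Valid D (σ :: s)) : WF D σ := h.2.wf

theorem WF.exists_group {N : Part G × List V} {P : Set V} (h : WF D (N, some P)) :
    ∃ v ∈ (dec D N).cov, P = (dec D N).gr v := h.2 P rfl

theorem Child.carrier_subset : ∀ {σ τ : State G}, WF D σ → Child D (some σ) τ →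
    τ.carrier ⊆ σ.carrier
  | (N, none), τ, _, h => by
    obtain ⟨rfl, v, hv, h2⟩ := h
    rw [State.carrier, h2]
    exact ((dec D τ.1).gr_subset v hv).trans (dec D τ.1).cov_subset
  | (N, some P), τ, hσ, h => by
    obtain ⟨h1, -, v, hv, hvP, h3⟩ := h
    obtain ⟨w, hw, rfl⟩ := hσ.exists_group
    rw [State.carrier, h1]
    show τ.1.1.1 ⊆ (dec D N).gr w
    rw [h3, ← (dec D N).gr_eq w hw v hvP]
    exact (dec D N).pc_subset v hv

/-- Components, groups and pieces are classes of partitions, and the parent determines the remaining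
data of a child, including its queue. -/
theorem Child.eq_of_mem : ∀ {p : Option (State G)} {σ τ : State G} {x : V}, Child D p σ →
    Child D p τ → x ∈ σ.carrier → x ∈ τ.carrier → σ = τ
  | none, ((A, q), o), ((A', q'), o'), x, h, h', hx, hx' => by
    obtain ⟨rfl, rfl, v, hv⟩ := h
    obtain ⟨rfl, rfl, w, hw⟩ := h'
    obtain rfl : A = A' := by
      refine Subtype.ext ?_
      have e1 : x ∈ A.1 := hx
      have e2 : x ∈ A'.1 := hx'
      simp only at hv hw
      rw [hv] at e1 ⊢
      rw [hw] at e2 ⊢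
      exact (comp_eq e1).symm.trans (comp_eq e2)
    rfl
  | some (N, none), (M, o), (M', o'), x, h, h', hx, hx' => by
    obtain ⟨rfl, v, hv, h2⟩ := h
    obtain ⟨rfl, w, hw, h2'⟩ := h'
    simp only at h2 h2'
    subst h2 h2'
    have e : (dec D M').gr v = (dec D M').gr w :=
      ((dec D M').gr_eq v hv x hx).symm.trans ((dec D M').gr_eq w hw x hx')
    simp only at e ⊢
    rw [e]
  | some (N, some P), ((A, q), o), ((A', q'), o'), x, h, h', hx, hx' => by
    obtain ⟨rfl, h2, v, hv, -, h3⟩ := h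
    obtain ⟨rfl, h2', w, hw, -, h3'⟩ := h'
    obtain rfl : A = A' := by
      refine Subtype.ext ?_
      have e1 : x ∈ A.1 := hx
      have e2 : x ∈ A'.1 := hx'
      simp only at h3 h3'
      rw [h3] at e1 ⊢
      rw [h3'] at e2 ⊢
      exact ((dec D N).pc_eq v hv x e1).symm.trans ((dec D N).pc_eq w hw x e2)
    simp only at h2 h2'
    rw [h2, h2']

/-- By `apart`, a ray inside a group cannot be edge-dominated by `m`: it would be separated from
itself. -/
theorem Decomp.evIn_pc {A : Set V} {m : V} (d : Decomp G A m) {v : V} (hv : v ∈ d.cov)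
    {r : Ray G} (hr : r.EvIn (d.gr v)) : ∃ u ∈ d.gr v, r.EvIn (d.pc u) := by
  rcases d.dichotomy r (hr.mono ((d.gr_subset v hv).trans d.cov_subset)) with h | ⟨u, hu, hev⟩
  · obtain ⟨S, hS, hsep⟩ := d.apart r h v hv
    exact absurd (hsep r hr) (not_separates_self hS r)
  · obtain ⟨w, hw, hw'⟩ := (hr.inter hev).nonempty
    exact ⟨w, hw, d.pc_eq u hu w hw' ▸ hev⟩

theorem Decomp.pc_subset_of_mem {A : Set V} {m : V} (d : Decomp G A m) {u v : V} (hv : v ∈ d.cov)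
    (hu : u ∈ d.gr v) : d.pc u ⊆ d.gr v := by
  rw [← d.gr_eq v hv u hu]
  exact d.pc_subset u (d.gr_subset v hv hu)

/-- A group may have infinite edge boundary, so the argument passes to one piece, whose boundary is
finite. -/
theorem Decomp.evIn_gr_of_toEnd_eq {A : Set V} {m : V} (d : Decomp G A m) {v : V} (hv : v ∈ d.cov)
    {r s : Ray G} (hr : r.EvIn (d.gr v)) (h : r.toEnd = s.toEnd) : s.EvIn (d.gr v) := by
  obtain ⟨u, hu, hev⟩ := d.evIn_pc hv hr
  exact (hev.of_toEnd_eq (d.bd_finite u (d.gr_subset v hv hu)) h).mono (d.pc_subset_of_mem hv hu)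

theorem WF.evIn_of_toEnd_eq {σ : State G} (hσ : WF D σ) {r s : Ray G} (hr : r.EvIn σ.carrier)
    (h : r.toEnd = s.toEnd) : s.EvIn σ.carrier := by
  obtain ⟨N, o⟩ := σ
  cases o with
  | none => exact Ray.EvIn.of_toEnd_eq (A := N.1.1) N.1.2.2.2 h hr
  | some P =>
    obtain ⟨v, hv, rfl⟩ := hσ.exists_group
    exact (dec D N).evIn_gr_of_toEnd_eq hv hr h

/-- The ends of the rays with a tail in `A`. -/
def endsIn (G : SimpleGraph V) (A : Set V) : Set (Ends G) := {ω | ∃ r : Ray G, r.toEnd = ω ∧ r.EvIn A}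

theorem endsIn_mono {A B : Set V} (h : A ⊆ B) : endsIn G A ⊆ endsIn G B :=
  fun _ ⟨r, hr, hA⟩ => ⟨r, hr, hA.mono h⟩

theorem exists_toEnd (ω : Ends G) : ∃ r : Ray G, r.toEnd = ω := Quotient.exists_rep ω

theorem isOpen_endNhd {S : Set V} (hS : S.Finite) (r : Ray G) : IsOpen (endNhd S r) :=
  TopologicalSpace.isOpen_generateFrom_of_mem ⟨S, r, hS, rfl⟩

theorem mem_endNhd_self {S : Set V} (hS : S.Finite) (r : Ray G) : r.toEnd ∈ endNhd S r :=
  ⟨r, rfl, not_separates_self hS r⟩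

theorem isOpen_endsIn {A : Set V} (hA : (bd G A).Finite) : IsOpen (endsIn G A) := by
  have : endsIn G A = ⋃ (r : Ray G) (_ : r.EvIn A), endNhd (touch (bd G A)) r := by
    ext ω
    simp only [Set.mem_iUnion]
    constructor
    · rintro ⟨r, rfl, hr⟩
      exact ⟨r, hr, mem_endNhd_self (touch_finite hA) r⟩
    · rintro ⟨r, hr, s, rfl, hs⟩
      exact ⟨s, rfl, hr.of_not_separates hs⟩
  rw [this]
  exact isOpen_iUnion fun r => isOpen_iUnion fun _ => isOpen_endNhd (touch_finite hA) r

theorem isClopen_endsIn {A : Set V} (hA : (bd G A).Finite) : IsClopen (endsIn G A) := by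
  refine ⟨⟨?_⟩, isOpen_endsIn hA⟩
  have : (endsIn G A)ᶜ = endsIn G Aᶜ := by
    ext ω
    obtain ⟨r, rfl⟩ := exists_toEnd ω
    constructor
    · intro h
      exact ⟨r, rfl, (r.evIn_or_compl hA).resolve_left fun hr => h ⟨r, rfl, hr⟩⟩
    · rintro ⟨s, hs, hsA⟩ ⟨t, ht, htA⟩
      exact (htA.of_toEnd_eq hA (ht.trans hs.symm)).not_compl hsA
  rw [this]
  exact isOpen_endsIn (by rw [bd_compl]; exact hA)

/-- Open as a union over pieces. An end outside has a neighbourhood missing the group: one given by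
`apart` if it is edge-dominated by `m`, another piece, or the complement of `A`. -/
theorem Decomp.isClopen_endsIn_gr {A : Set V} (hA : (bd G A).Finite) {m : V} (d : Decomp G A m)
    {v : V} (hv : v ∈ d.cov) : IsClopen (endsIn G (d.gr v)) := by
  constructor
  · refine ⟨isOpen_iff_forall_mem_open.2 fun ω hω => ?_⟩
    obtain ⟨r, rfl⟩ := exists_toEnd ω
    rcases r.evIn_or_compl hA with hr | hr
    · rcases d.dichotomy r hr with h | ⟨u, hu, hev⟩
      · obtain ⟨S, hS, hsep⟩ := d.apart r h v hv
        refine ⟨endNhd S r, ?_, isOpen_endNhd hS r, mem_endNhd_self hS r⟩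
        rintro _ ⟨s, rfl, hs⟩ ⟨t, ht, htv⟩
        exact hs (hsep s (d.evIn_gr_of_toEnd_eq hv htv ht))
      · refine ⟨endsIn G (d.pc u), ?_, isOpen_endsIn (d.bd_finite u hu), r, rfl, hev⟩
        rintro _ ⟨s, rfl, hs⟩ ⟨t, ht, htv⟩
        obtain ⟨w, hw, hw'⟩ := (hs.inter (d.evIn_gr_of_toEnd_eq hv htv ht)).nonempty
        have := d.pc_subset_of_mem hv hw'
        rw [d.pc_eq u hu w hw] at this
        exact hω ⟨r, rfl, hev.mono this⟩
    · refine ⟨endsIn G Aᶜ, ?_, isOpen_endsIn (by rw [bd_compl]; exact hA), r, rfl, hr⟩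
      rintro _ ⟨s, rfl, hs⟩ ⟨t, ht, htv⟩
      exact (((d.evIn_gr_of_toEnd_eq hv htv ht).mono
        ((d.gr_subset v hv).trans d.cov_subset))).not_compl hs
  · have : endsIn G (d.gr v) = ⋃ u ∈ d.gr v, endsIn G (d.pc u) := by
      refine Set.Subset.antisymm ?_ (Set.iUnion₂_subset fun u hu =>
        endsIn_mono (d.pc_subset_of_mem hv hu))
      rintro _ ⟨r, rfl, hr⟩
      obtain ⟨u, hu, hev⟩ := d.evIn_pc hv hr
      exact Set.mem_biUnion hu ⟨r, rfl, hev⟩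
    rw [this]
    exact isOpen_biUnion fun u hu => isOpen_endsIn (d.bd_finite u (d.gr_subset v hv hu))

theorem WF.isClopen {σ : State G} (hσ : WF D σ) : IsClopen (endsIn G σ.carrier) := by
  obtain ⟨N, o⟩ := σ
  cases o with
  | none => exact isClopen_endsIn (A := N.1.1) N.1.2.2.2
  | some P =>
    obtain ⟨v, hv, rfl⟩ := hσ.exists_group
    exact (dec D N).isClopen_endsIn_gr N.1.2.2.2 hv

variable (D) in
/-- The ends living at the last state of a valid sequence. -/
def stateEnds : List (State G) → Set (Ends G)
  | [] => Set.univ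
  | σ :: s => {ω | Valid D (σ :: s) ∧ ω ∈ endsIn G σ.carrier}

/-! ### Infinite sequences of states -/

section Infinite

variable {f : ℕ → State G} (hf : ∀ n, Valid D (initSeg f n))
include hf

theorem child_succ (n : ℕ) : Child D (some (f n)) (f (n + 1)) := (hf (n + 2)).2

theorem wf_seq (n : ℕ) : WF D (f n) := (hf (n + 1)).wf

theorem carrier_anti : Antitone fun n => (f n).carrier :=
  antitone_nat_of_succ_le fun n => (child_succ hf n).carrier_subset (wf_seq hf n)

theorem even_step {n : ℕ} (h : (f n).2 = none) : (f (n + 2)).2 = none ∧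
    (f (n + 2)).1.2 = (f n).1.2.tail ++ innerList (f (n + 2)).1.1 ∧
    (f (n + 2)).carrier ⊆ (dec D (f n).1).cov := by
  have h1 := child_succ hf n
  have h2 := child_succ hf (n + 1)
  generalize f n = σ at h h1
  generalize f (n + 1) = τ at h1 h2
  generalize f (n + 1 + 1) = ρ at h2
  obtain ⟨N, o⟩ := σ
  obtain ⟨N', o'⟩ := τ
  simp only at h
  subst h
  obtain ⟨rfl, v, hv, h1⟩ := h1
  simp only at h1
  subst h1
  obtain ⟨e1, e2, w, hw, -, e3⟩ := h2
  refine ⟨e1, e2, ?_⟩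
  rw [State.carrier, e1]
  show ρ.1.1.1 ⊆ _
  rw [e3]
  exact ((dec D N').pc_subset w hw).trans ((dec D N').gr_subset w hw)

theorem even_none (n : ℕ) : (f (2 * n)).2 = none := by
  induction n with
  | zero => exact (hf 1).2.1
  | succ n ih => exact (even_step hf ih).1

theorem carrier_even (n : ℕ) : (f (2 * n)).carrier = (f (2 * n)).1.1.1 := by
  rw [State.carrier, even_none hf n]
  rfl

/-- The queue is served in order, and new vertices are appended behind. When its turn comes, a
vertex has already left the part or is the decomposition vertex, which no piece contains. -/
theorem exists_notMem_of_mem_queue {x : V} : ∀ (l l' : List V) (n : ℕ),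
    (f (2 * n)).1.2 = l ++ l' → x ∈ l → ∃ k, x ∉ (f k).carrier := by
  intro l
  induction l with
  | nil => intro l' n _ h; simp at h
  | cons y l ih =>
    intro l' n hq hx
    obtain ⟨-, h2, h3⟩ := even_step hf (even_none hf n)
    rcases List.mem_cons.1 hx with rfl | hx
    · by_cases hxA : x ∈ (f (2 * n)).1.1.1
      · refine ⟨2 * n + 2, fun h => ?_⟩
        have hmem : ∀ y, y = x → y ∈ (dec D (f (2 * n)).1).cov := fun y hy => hy ▸ h3 h
        exact (dec D (f (2 * n)).1).notMem (hmem _ (pick_eq hxA hq))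
      · exact ⟨2 * n, by rwa [carrier_even hf]⟩
    · refine ih (l' ++ innerList (f (2 * (n + 1))).1.1) (n + 1) ?_ hx
      rw [hq, List.cons_append, List.tail_cons, List.append_assoc] at h2
      exact h2

/-- If `v` survived forever, so would its neighbours, since otherwise it would be queued as a
boundary vertex. Then its whole component survives, although the first decomposition vertex is
removed. -/
theorem exists_notMem_carrier (v : V) : ∃ n, v ∉ (f n).carrier := by
  by_contra! hv
  have hclosed : ∀ x y, (∀ n, x ∈ (f n).carrier) → G.Adj x y → ∀ n, y ∈ (f n).carrier := by
    intro x y hx hxy n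
    by_contra hy
    have hy' : y ∉ (f (2 * n)).1.1.1 := by
      rw [← carrier_even hf]
      exact fun h => hy (carrier_anti hf (by omega : n ≤ 2 * n) h)
    have hxA : x ∈ (f (2 * n)).1.1.1 := by
      rw [← carrier_even hf]
      exact hx _
    have hq := (wf_seq hf (2 * n)).1 (even_none hf n) x hxA y hy' hxy
    obtain ⟨k, hk⟩ := exists_notMem_of_mem_queue hf _ [] n (by simp) hq
    exact hk (hx k)
  obtain ⟨h1, -, w, hw⟩ := (hf 1).2
  have hvc : v ∈ (f 0).1.1.1 := by
    have := hv 0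
    rwa [State.carrier, h1] at this
  have hm := (pick (f 0).1).2
  have hj : JoinedOff G ∅ v (pick (f 0).1).1 := by
    have hv' : v ∈ comp G ∅ w := hw ▸ hvc
    have hm' : (pick (f 0).1).1 ∈ comp G ∅ w := hw ▸ hm
    exact (JoinedOff.symm hv').trans hm'
  have := hj.induct (P := fun y => ∀ n, y ∈ (f n).carrier) hv
    fun x y hx _ _ hxy => hclosed x y hx hxy
  exact (dec D (f 0).1).notMem ((even_step hf (n := 0) h1).2.2 (this 2))

theorem exists_disjoint_carrier {S : Set V} (hS : S.Finite) :
    ∃ n, Disjoint (f (2 * n)).carrier S := by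
  choose ν hν using exists_notMem_carrier hf
  obtain ⟨K, hK⟩ := (hS.image ν).bddAbove
  refine ⟨K, Set.disjoint_left.2 fun v hv hvS => hν v ?_⟩
  have := hK (Set.mem_image_of_mem ν hvS)
  exact carrier_anti hf (by omega : ν v ≤ 2 * K) hv

/-- Some part of the branch misses `S`, and parts are connected. -/
theorem not_separates_of_evIn_seq {S : Set V} (hS : S.Finite) : ∃ n, ∀ r s : Ray G,
    r.EvIn (f n).carrier → s.EvIn (f n).carrier → ¬ Separates S r s := by
  obtain ⟨n, hn⟩ := exists_disjoint_carrier hf hS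
  refine ⟨2 * n, fun r s hr hs => ?_⟩
  rw [carrier_even hf] at hn hr hs
  obtain ⟨N, hN⟩ := hr
  obtain ⟨M, hM⟩ := hs
  exact not_not.2 ⟨max N M, fun i hi j hj => (f (2 * n)).1.1.2.2.1.joinedOff hn
    (hN i (le_trans (le_max_left _ _) hi)) (hM j (le_trans (le_max_right _ _) hj))⟩

theorem exists_ray_seq : ∃ r : Ray G, ∀ n, r.EvIn (f n).carrier := by
  obtain ⟨r, hr⟩ := exists_ray_of_chain (G := G) (A := fun n => (f (2 * n)).carrier)
    (fun n => carrier_anti hf (by omega)) (fun n => by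
      rw [carrier_even hf]; exact (f (2 * n)).1.1.2.1) (fun n => by
      rw [carrier_even hf]; exact (f (2 * n)).1.1.2.2.1) fun v => by
      obtain ⟨n, hn⟩ := exists_notMem_carrier hf v
      exact ⟨n, fun h => hn (carrier_anti hf (by omega : n ≤ 2 * n) h)⟩
  exact ⟨r, fun n => (hr n).mono (carrier_anti hf (by omega : n ≤ 2 * n))⟩

end Infinite

/-! ### The end space is addressed by the tree of states -/

theorem valid_of_nonempty : ∀ {s : List (State G)}, (stateEnds D s).Nonempty → Valid D s
  | [], _ => trivial
  | _ :: _, ⟨_, h⟩ => h.1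

theorem exists_child_nil (ω : Ends G) : ∃ σ, ω ∈ stateEnds D [σ] := by
  obtain ⟨r, rfl⟩ := exists_toEnd ω
  have hcomp : ∀ n, r.vert n ∈ comp G ∅ (r.vert 0) := by
    intro n
    induction n with
    | zero => exact JoinedOff.refl (Set.notMem_empty _)
    | succ n ih =>
      exact JoinedOff.trans ih (JoinedOff.of_adj (r.adj n) (Set.notMem_empty _) (Set.notMem_empty _))
  have hbd : bd G (comp G ∅ (r.vert 0)) = ∅ := by
    rw [Set.eq_empty_iff_forall_notMem]
    rintro _ ⟨x, y, hxy, hx, hy, rfl⟩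
    exact hy (JoinedOff.trans hx
      (JoinedOff.of_adj hxy (Set.notMem_empty _) (Set.notMem_empty _)))
  exact ⟨((⟨comp G ∅ (r.vert 0), ⟨_, hcomp 0⟩, connSet_comp _ _, hbd ▸ Set.finite_empty⟩, []), none),
    ⟨trivial, rfl, rfl, _, rfl⟩, r, rfl, 0, fun n _ => hcomp n⟩

theorem exists_child_group {N : Part G × List V} {P : Set V} {s : List (State G)} {ω : Ends G}
    (h : ω ∈ stateEnds D ((N, some P) :: s)) : ∃ σ, ω ∈ stateEnds D (σ :: (N, some P) :: s) := by
  obtain ⟨hval, r, rfl, hr⟩ := h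
  obtain ⟨v, hv, rfl⟩ := hval.wf.exists_group
  obtain ⟨u, hu, hev⟩ := (dec D N).evIn_pc hv hr
  have huc := (dec D N).gr_subset v hv hu
  let K : Part G := ⟨(dec D N).pc u, ⟨u, (dec D N).mem_pc u huc⟩, (dec D N).conn u huc,
    (dec D N).bd_finite u huc⟩
  exact ⟨((K, N.2.tail ++ innerList K), none), ⟨hval, rfl, rfl, u, huc, hu, rfl⟩, r, rfl, hev⟩

theorem child_of_evIn_pc {N : Part G × List V} {s : List (State G)} {r : Ray G}
    (h : Valid D ((N, none) :: s)) {v : V} (hv : v ∈ (dec D N).cov)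
    (hr : r.EvIn ((dec D N).pc v)) :
    r.toEnd ∈ stateEnds D ((N, some ((dec D N).gr v)) :: (N, none) :: s) :=
  ⟨⟨h, rfl, v, hv, rfl⟩, r, rfl, hr.mono ((dec D N).pc_subset v hv)⟩

/-- An end that lies in no child of a state is edge-dominated by the chosen vertex. -/
theorem exists_of_forall_notMem {s : List (State G)} {r : Ray G} (hs : r.toEnd ∈ stateEnds D s)
    (hi : ∀ i, r.toEnd ∉ stateEnds D (i :: s)) :
    ∃ N t, s = (N, none) :: t ∧ EdgeDominates (pick N).1 r := by
  cases s with
  | nil =>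
    obtain ⟨σ, hσ⟩ := exists_child_nil (D := D) r.toEnd
    exact absurd hσ (hi σ)
  | cons σ t =>
    obtain ⟨N, o⟩ := σ
    cases o with
    | some P =>
      obtain ⟨σ, hσ⟩ := exists_child_group hs
      exact absurd hσ (hi σ)
    | none =>
      refine ⟨N, t, rfl, ?_⟩
      obtain ⟨hval, r', hr', hev⟩ := hs
      rcases (dec D N).dichotomy r (Ray.EvIn.of_toEnd_eq (A := N.1.1) N.1.2.2.2 hr' hev) with
        h | ⟨v, hv, h⟩
      · exact h
      · exact absurd (child_of_evIn_pc hval hv h) (hi _)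

theorem exists_finite_endNhd_subset {O : Set (Ends G)} (hO : IsOpen O) {r : Ray G}
    (hr : r.toEnd ∈ O) : ∃ S : Set V, S.Finite ∧ endNhd S r ⊆ O := by
  induction hO with
  | basic U hU =>
    obtain ⟨S, s, hS, rfl⟩ := hU
    obtain ⟨t, ht, hst⟩ := hr
    refine ⟨S, hS, ?_⟩
    rintro _ ⟨t', rfl, ht'⟩
    exact ⟨t', rfl, not_separates_trans (not_separates_trans hst (toEnd_eq_iff.1 ht S hS)) ht'⟩
  | univ => exact ⟨∅, Set.finite_empty, Set.subset_univ _⟩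
  | inter U W _ _ ihU ihW =>
    obtain ⟨S, hS, hSU⟩ := ihU hr.1
    obtain ⟨T, hT, hTW⟩ := ihW hr.2
    have hmono : ∀ {A B : Set V} {s : Ray G}, A ⊆ B → ¬ Separates B r s → ¬ Separates A r s := by
      intro A B s hAB h
      obtain ⟨N, hN⟩ := not_not.1 h
      exact not_not.2 ⟨N, fun m hm n hn => (hN m hm n hn).mono le_rfl hAB⟩
    refine ⟨S ∪ T, hS.union hT, ?_⟩
    rintro _ ⟨s, rfl, hs⟩
    exact ⟨hSU ⟨s, rfl, hmono Set.subset_union_left hs⟩, hTW ⟨s, rfl, hmono Set.subset_union_right hs⟩⟩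
  | sUnion 𝒰 _ ih =>
    obtain ⟨U, hU, hrU⟩ := hr
    obtain ⟨S, hS, hSU⟩ := ih U hU hrU
    exact ⟨S, hS, hSU.trans (Set.subset_sUnion_of_mem hU)⟩

theorem evIn_of_mem_stateEnds {σ : State G} {s : List (State G)} {r : Ray G}
    (h : r.toEnd ∈ stateEnds D (σ :: s)) : r.EvIn σ.carrier := by
  obtain ⟨hval, t, ht, hev⟩ := h
  exact hval.wf.evIn_of_toEnd_eq hev ht

variable (D) in
-- A finite address stops at a part whose decomposition vertex edge-dominates the end. By `hG` only
-- one end stops there, which gives `sep`, and `close` gives `base` by removing finitely many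
-- groups. Along an infinite address the parts eventually avoid any finite vertex set, so no child
-- need be removed.
theorem addressSystem_stateEnds (hG : ∀ (v : V) (ω η : Ends G), EdgeDominatesEnd v ω →
    EdgeDominatesEnd v η → ω = η) : AddressSystem (stateEnds D) where
  nil := rfl
  mono := by
    rintro σ s ω ⟨hval, hω⟩
    cases s with
    | nil => trivial
    | cons τ t => exact ⟨hval.1, endsIn_mono (hval.2.carrier_subset hval.1.wf) hω⟩
  disj := by
    rintro ω s σ τ h h'
    obtain ⟨r, rfl⟩ := exists_toEnd ω
    obtain ⟨x, hx, hx'⟩ := ((evIn_of_mem_stateEnds h).inter (evIn_of_mem_stateEnds h')).nonempty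
    exact h.1.2.eq_of_mem h'.1.2 hx hx'
  sep := by
    intro ω η heq
    obtain ⟨r, rfl⟩ := exists_toEnd ω
    obtain ⟨s, rfl⟩ := exists_toEnd η
    by_cases hfin : ∃ l, r.toEnd ∈ stateEnds D l ∧ ∀ i, r.toEnd ∉ stateEnds D (i :: l)
    · obtain ⟨l, hl, hi⟩ := hfin
      obtain ⟨N, t, rfl, hd⟩ := exists_of_forall_notMem hl hi
      obtain ⟨N', t', he, hd'⟩ := exists_of_forall_notMem ((heq _).1 hl)
        fun i h => hi i ((heq _).2 h)
      obtain rfl : N = N' := by simpa using (List.cons.inj he).1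
      exact hG _ _ _ ((edgeDominatesEnd_toEnd _ _).2 hd) ((edgeDominatesEnd_toEnd _ _).2 hd')
    · push Not at hfin
      obtain ⟨f, hf⟩ := exists_initSeg (P := fun l => r.toEnd ∈ stateEnds D l) trivial hfin
      have hval : ∀ n, Valid D (initSeg f n) := fun n => valid_of_nonempty ⟨_, hf n⟩
      rw [toEnd_eq_iff]
      intro S hS
      obtain ⟨n, hn⟩ := not_separates_of_evIn_seq hval hS
      exact hn r s (evIn_of_mem_stateEnds (hf (n + 1)))
        (evIn_of_mem_stateEnds ((heq _).1 (hf (n + 1))))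
  clopen := by
    intro s
    cases s with
    | nil => exact isClopen_univ
    | cons σ s =>
      by_cases h : Valid D (σ :: s)
      · have : stateEnds D (σ :: s) = endsIn G σ.carrier := by
          ext ω
          exact ⟨fun h' => h'.2, fun h' => ⟨h, h'⟩⟩
        rw [this]
        exact h.wf.isClopen
      · have : stateEnds D (σ :: s) = ∅ := by
          rw [Set.eq_empty_iff_forall_notMem]
          exact fun ω h' => h h'.1
        rw [this]
        exact isClopen_empty
  base := by
    intro ω O hO hω
    obtain ⟨r, rfl⟩ := exists_toEnd ω
    obtain ⟨S, hS, hSO⟩ := exists_finite_endNhd_subset hO hω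
    by_cases hfin : ∃ l, r.toEnd ∈ stateEnds D l ∧ ∀ i, r.toEnd ∉ stateEnds D (i :: l)
    · obtain ⟨l, hl, hi⟩ := hfin
      obtain ⟨N, t, rfl, hd⟩ := exists_of_forall_notMem hl hi
      obtain ⟨𝒯, h𝒯, hclose⟩ := (dec D N).close r hd S hS
      refine ⟨_, (fun T => (N, some T)) '' 𝒯, h𝒯.image _, hl, fun j _ => hi j, ?_⟩
      intro η hη hηJ
      obtain ⟨s, rfl⟩ := exists_toEnd η
      rcases (dec D N).dichotomy s (evIn_of_mem_stateEnds hη) with h | ⟨v, hv, h⟩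
      · rwa [hG _ _ _ ((edgeDominatesEnd_toEnd _ _).2 h) ((edgeDominatesEnd_toEnd _ _).2 hd)]
      · refine hSO ⟨s, rfl, hclose v hv (fun hgr => ?_) s h⟩
        exact hηJ _ ⟨_, hgr, rfl⟩ (child_of_evIn_pc hη.1 hv h)
    · push Not at hfin
      obtain ⟨f, hf⟩ := exists_initSeg (P := fun l => r.toEnd ∈ stateEnds D l) trivial hfin
      have hval : ∀ n, Valid D (initSeg f n) := fun n => valid_of_nonempty ⟨_, hf n⟩
      obtain ⟨n, hn⟩ := not_separates_of_evIn_seq hval hS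
      refine ⟨initSeg f (n + 1), ∅, Set.finite_empty, hf _, by simp, fun η hη _ => ?_⟩
      obtain ⟨s, rfl⟩ := exists_toEnd η
      exact hSO ⟨s, rfl, hn r s (evIn_of_mem_stateEnds (hf (n + 1))) (evIn_of_mem_stateEnds hη)⟩
  complete := by
    intro f hf
    have hval : ∀ n, Valid D (initSeg f n) := fun n => valid_of_nonempty (hf n)
    obtain ⟨r, hr⟩ := exists_ray_seq hval
    refine ⟨r.toEnd, fun n => ?_⟩
    cases n with
    | zero => trivial
    | succ n => exact ⟨hval (n + 1), r, rfl, hr n⟩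

end EndSpaces

theorem mainTheorem4 {V : Type u} (G : SimpleGraph V)
    (hG : ∀ (v : V) (ω η : EndSpaces.Ends G),
      EndSpaces.EdgeDominatesEnd v ω → EndSpaces.EdgeDominatesEnd v η → ω = η) :
    ∃ (W : Type u) (H : SimpleGraph W),
      Nonempty (EndSpaces.EdgeEnds H ≃ₜ EndSpaces.Ends G) := by
  have D : EndSpaces.DecompChoice G := fun A m =>
    (EndSpaces.exists_decomp hG A.2.2.1 A.2.2.2 m.2).some
  exact ⟨_, _, (EndSpaces.addressSystem_stateEnds D hG).exists_homeomorph⟩
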